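/- Let $\rho=(\rho_n)_{n\ge 1}$ be a state: each $\rho_n$ is a density matrix on $\mathbb{C}^{2^n}$ (Hermitian, positive semidefinite, of trace $1$), and for all $n>1$ tracing out the last qubit of $\rho_n$ gives $\rho_{n-1}$. For a projection $G$ on $\mathbb{C}^{2^n}$ put $\rho(G)=\operatorname{Tr}(\rho_nG)$ and $\tau(G)=2^{-n}\operatorname{Tr}(G)$. Represent a complex algebraic number by a nonzero integer polynomial together with an open disc with rational data in which the number is the only root of the polynomial. A sequence of $2^{q_m}\times 2^{q_m}$ matrices with complex algebraic entries is computable if $(q_m)_m$ is computable and representations of the entries can be computed uniformly in $m$ and in the indices of the entry. The state $\rho$ is computable if the $\rho_n$ have complex algebraic entries and $(\rho_n)_n$ is computable in this sense. A quantum Schnorr test is a computable sequence $(S^m)_m$ of Hermitian projection matrices with complex algebraic entries, where $S^m$ acts on $\mathbb{C}^{2^{q_m}}$ with $q_m\ge 1$, such that $\sum_m\tau(S^m)$ is finite and a computable real number $r$ (that is, there is a computable sequence of rationals $(\varphi(k))_k$ with $|r-\varphi(k)|\le 2^{-k}$ for all $k$). The state $\rho$ is quantum Schnorr random if, for every quantum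 Schnorr test $(S^m)_m$ and every $\delta>0$, $\rho(S^m)>\delta$ holds for only finitely many $m$. **Theorem.** If $\rho$ is computable and quantum Schnorr random, then $$\lim_{n\to\infty}\frac{H(\rho_n)}{n}=1,$$ where $H(d)=-\sum_i\alpha_i\log_2\alpha_i$ is the von Neumann entropy of a density matrix $d$ with eigenvalues $(\alpha_i)_i$, counted with multiplicity (and $0\log_2 0=0$). -/

import Mathlib

open Filter Topology
open scoped ComplexOrder

namespace QuantumRandomness

/-! ### Codes for rationals and for complex algebraic numbers -/

/-- A pair `(a, k)` is a code for the rational number `a / (k + 1)`. -/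
abbrev RatCode : Type := ℤ × ℕ

/-- The rational number with code `(a, k)`. -/
def RatCode.val (c : RatCode) : ℚ := (c.1 : ℚ) / ((c.2 : ℚ) + 1)

/-- The integer polynomial with the listed coefficients, the constant one first. -/
noncomputable def polyOfList : List ℤ → Polynomial ℤ
  | [] => 0
  | a :: l => Polynomial.C a + Polynomial.X * polyOfList l

/-- A finite code for a complex algebraic number: the coefficients of an integer polynomial,
and the real part, the imaginary part of the centre and the radius of an open disc with
rational data. It names the root of the polynomial in the disc, if there is exactly one. Such
data can be regarded as a natural number through `Encodable.encode`. -/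
abbrev AlgCode : Type := List ℤ × RatCode × RatCode × RatCode

/-- The centre of the disc of a code. -/
noncomputable def AlgCode.center (c : AlgCode) : ℂ := ⟨(c.2.1.val : ℝ), (c.2.2.1.val : ℝ)⟩

/-- The open disc of a code. -/
noncomputable def AlgCode.disc (c : AlgCode) : Set ℂ :=
  Metric.ball c.center (c.2.2.2.val : ℝ)

/-- `c.Represents z`: the polynomial of `c` is not zero and `z` is its only root in the
disc of `c`. -/
def AlgCode.Represents (c : AlgCode) (z : ℂ) : Prop :=
  polyOfList c.1 ≠ 0 ∧
    ∀ w : ℂ, (w ∈ c.disc ∧ Polynomial.aeval w (polyOfList c.1) = 0) ↔ w = z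

/-- A real number `r` is computable if a computable sequence of rationals `φ` satisfies
`|r - φ n| ≤ 2⁻ⁿ` for all `n`. -/
def IsComputableReal (r : ℝ) : Prop :=
  ∃ φ : ℕ → RatCode, Computable φ ∧ ∀ n, |r - ((φ n).val : ℝ)| ≤ (2 : ℝ)⁻¹ ^ n

/-- A computable sequence of matrices with complex algebraic entries, the `m`-th one acting on
`q m` qubits: the sequence of the sizes is computable, and codes of the entries are computable
from `m` and the indices of the entry (uniformly in `m`). -/
def IsComputableMatrixSeq (q : ℕ → ℕ)
    (M : ∀ m, Matrix (Fin (2 ^ q m)) (Fin (2 ^ q m)) ℂ) : Prop :=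
  Computable q ∧ ∃ c : ℕ × ℕ × ℕ → AlgCode, Computable c ∧
    ∀ (m : ℕ) (i j : Fin (2 ^ q m)), (c (m, (i : ℕ), (j : ℕ))).Represents (M m i j)

/-! ### States -/

/-- The basis index of `|i⟩ ⊗ |b⟩`, where `i` indexes the computational basis of `n` qubits
and `b` that of one further, last qubit. -/
def appendQubit {n : ℕ} (i : Fin (2 ^ n)) (b : Fin 2) : Fin (2 ^ (n + 1)) :=
  ⟨2 * i + b, by have := i.isLt; have := b.isLt; rw [pow_succ]; omega⟩

/-- The partial trace that traces out the last qubit. -/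
def partialTraceLast {n : ℕ} (d : Matrix (Fin (2 ^ (n + 1))) (Fin (2 ^ (n + 1))) ℂ) :
    Matrix (Fin (2 ^ n)) (Fin (2 ^ n)) ℂ :=
  Matrix.of fun i j => ∑ b : Fin 2, d (appendQubit i b) (appendQubit j b)

/-- A density matrix: Hermitian, positive semidefinite (`Matrix.PosSemidef` includes
both) and of trace one. -/
structure IsDensityMatrix {ι : Type*} [Fintype ι] (d : Matrix ι ι ℂ) : Prop where
  posSemidef : d.PosSemidef
  trace_eq_one : d.trace = 1

/-- The von Neumann entropy: the Shannon entropy, to the base two, of the eigenvalues counted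
with multiplicity (here `0 * Real.logb 2 0 = 0`, the usual convention). -/
noncomputable def vonNeumannEntropy {ι : Type*} [Fintype ι] [DecidableEq ι] {d : Matrix ι ι ℂ}
    (hd : IsDensityMatrix d) : ℝ :=
  -∑ i, hd.posSemidef.isHermitian.eigenvalues i *
    Real.logb 2 (hd.posSemidef.isHermitian.eigenvalues i)

/-- A state: a coherent sequence `ρ_n` of density matrices on `n` qubits. The entry `mat 0`
is necessarily the `1 × 1` matrix `1`, and it imposes nothing on the others. -/
structure QState where
  mat : ∀ n : ℕ, Matrix (Fin (2 ^ n)) (Fin (2 ^ n)) ℂ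
  density : ∀ n, IsDensityMatrix (mat n)
  coherent : ∀ n, partialTraceLast (mat (n + 1)) = mat n

/-- The von Neumann entropy of the first `n` qubits. -/
noncomputable def QState.entropy (ρ : QState) (n : ℕ) : ℝ := vonNeumannEntropy (ρ.density n)

/-- `ρ(G) = Tr (ρ_n G)`, for a projection `G` on `n` qubits (this trace is real). -/
noncomputable def QState.measure (ρ : QState) {n : ℕ}
    (G : Matrix (Fin (2 ^ n)) (Fin (2 ^ n)) ℂ) : ℝ :=
  ((ρ.mat n * G).trace).re

/-- A state is computable if its matrices form a computable sequence of matrices with complex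
algebraic entries. -/
def QState.IsComputable (ρ : QState) : Prop := IsComputableMatrixSeq (fun n => n) ρ.mat

/-- The tracial state, whose `n`-th matrix is `2⁻ⁿ` times the identity. -/
noncomputable def tracialState : QState where
  mat n := ((2 : ℂ) ^ n)⁻¹ • (1 : Matrix (Fin (2 ^ n)) (Fin (2 ^ n)) ℂ)
  density n :=
    { posSemidef := Matrix.PosSemidef.one.smul (by positivity)
      trace_eq_one := by simp [Matrix.trace_smul, Matrix.trace_one] }
  coherent n := by
    ext i j
    by_cases h : i = j
    · subst h
      simp only [partialTraceLast, Matrix.of_apply, Matrix.smul_apply, Matrix.one_apply_eq, pow_succ,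
        mul_inv, smul_eq_mul, Fin.sum_univ_two]
      ring
    · have h' : ∀ b : Fin 2, appendQubit i b ≠ appendQubit j b := by
        intro b hb
        apply h
        simp only [appendQubit, Fin.mk.injEq] at hb
        exact Fin.ext (by omega)
      simp [partialTraceLast, Matrix.one_apply, h, h']

/-! ### Quantum Schnorr randomness -/

/-- A special projection: a Hermitian projection matrix with complex algebraic entries. -/
def IsSpecialProjection {ι : Type*} [Fintype ι] (G : Matrix ι ι ℂ) : Prop :=
  IsStarProjection G ∧ ∀ i j, IsAlgebraic ℚ (G i j)

/-- A quantum Schnorr test: a computable sequence of special projections, the `m`-th one on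
`qubits m ≥ 1` qubits, whose traces (with respect to the tracial state) have a finite and
computable sum. -/
structure QSchnorrTest where
  qubits : ℕ → ℕ
  one_le_qubits : ∀ m, 1 ≤ qubits m
  proj : ∀ m, Matrix (Fin (2 ^ qubits m)) (Fin (2 ^ qubits m)) ℂ
  special : ∀ m, IsSpecialProjection (proj m)
  computable : IsComputableMatrixSeq qubits proj
  summable : Summable fun m => tracialState.measure (proj m)
  computable_sum : IsComputableReal (∑' m, tracialState.measure (proj m))

/-- `ρ` fails the test `S` at order `δ`: `ρ(S^m) > δ` for infinitely many `m`. -/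
def QState.FailsAt (ρ : QState) (S : QSchnorrTest) (δ : ℝ) : Prop :=
  ∃ᶠ m in atTop, δ < ρ.measure (S.proj m)

/-- A state is quantum Schnorr random if it passes all quantum Schnorr tests at all orders
`δ > 0`. -/
def QState.IsSchnorrRandom (ρ : QState) : Prop :=
  ∀ (S : QSchnorrTest) (δ : ℝ), 0 < δ → ¬ ρ.FailsAt S δ

end QuantumRandomness

/-! ### Computable integer arithmetic -/

/-! Argue by contraposition. The entropy rate never exceeds 1, so if it does not tend to 1, then
`H(ρ_n) ≤ a n` for some `a < 1` and infinitely many `n`. Fix `a < b < 1`. Markov's inequality for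
`-log₂ αᵢ` (`exists_finset_of_entropy_le`) shows that the at most `2^(bn)` eigenvectors with
eigenvalue at least `2^(-bn)` carry mass at least `1 - a/b`. Once `(1 - b) n ≥ m`, they can be
completed to `2^(n-m)` eigenvectors, which span a projection with `τ = 2^(-m)` exactly and with
`ρ`-mass bounded below independently of `m`. Such projections would form a test that `ρ` fails, with
the computable sum 2, if they could be found effectively.

Effectiveness comes from a search that avoids computing eigenvectors or doing exact arithmetic with
algebraic numbers. By `Matrix.exists_gaussianRational_projection` the projection may be taken over
`ℚ(i)` with the same rank. The matrix `ρ_n` is replaced by a Gaussian rational approximation whose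
quality is certified by integer inequalities: a small polynomial value forces a nearby root, and the
isolating disc identifies that root (`AlgCode.Represents.norm_sub_le`,
`AlgCode.Represents.eventually_certifies`). Being a good candidate is then decidable
(`MatrixPairCode.computablePred_isGood`), good candidates exist for every `m`
(`MatrixPairCode.exists_isGood`), they do have large mass (`MatrixPairCode.IsGood.inv_le_measure`),
and `ComputablePred.exists_computable` finds them. -/

theorem Int.encode_natCast (n : ℕ) : Encodable.encode (n : ℤ) = 2 * n := rfl

theorem Int.encode_negSucc (n : ℕ) : Encodable.encode (Int.negSucc n) = 2 * n + 1 := rfl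

namespace Primrec

/-- Nonnegative integers have even codes and negative ones odd codes, so parity gives the sign and
halving the size. -/
theorem int_toNat : Primrec Int.toNat := by
  have h : Primrec fun z : ℤ => _root_.cond (Encodable.encode z).bodd 0 (Encodable.encode z).div2 :=
    cond (nat_bodd.comp Primrec.encode) (const 0) (nat_div2.comp Primrec.encode)
  refine h.of_eq fun z => ?_
  cases z with
  | ofNat n =>
    have := Int.encode_natCast n
    simp only [Int.ofNat_eq_natCast]
    rw [this]; simp
  | negSucc n => rw [Int.encode_negSucc]; simp

theorem int_toNat_neg : Primrec fun z : ℤ => (-z).toNat := by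
  have h : Primrec fun z : ℤ =>
      _root_.cond (Encodable.encode z).bodd ((Encodable.encode z).div2 + 1) 0 :=
    cond (nat_bodd.comp Primrec.encode) (succ.comp (nat_div2.comp Primrec.encode)) (const 0)
  refine h.of_eq fun z => ?_
  cases z with
  | ofNat n =>
    have := Int.encode_natCast n
    simp only [Int.ofNat_eq_natCast]
    rw [this]; simp
  | negSucc n => rw [Int.encode_negSucc]; simp [Int.neg_negSucc]

/-- The remaining ring operations split their arguments into positive and negative parts and return
to `ℤ` through this difference. -/
theorem int_subNatNat : Primrec₂ fun a b : ℕ => (a : ℤ) - b := by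
  have h : Primrec fun p : ℕ × ℕ =>
      if p.2 ≤ p.1 then 2 * (p.1 - p.2) else 2 * (p.2 - p.1 - 1) + 1 :=
    ite (nat_le.comp snd fst) (nat_double.comp (nat_sub.comp fst snd))
      (nat_double_succ.comp (nat_sub.comp (nat_sub.comp snd fst) (const 1)))
  refine ((Primrec.ofNat ℤ).comp h).of_eq fun p => ?_
  beta_reduce
  rw [← Denumerable.ofNat_encode ((p.1 : ℤ) - p.2)]
  congr 1
  split_ifs with hp
  · rw [← Int.encode_natCast, Nat.cast_sub hp]
  · rw [← Int.encode_negSucc]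
    congr 1
    omega

theorem int_natCast : Primrec fun n : ℕ => (n : ℤ) :=
  (int_subNatNat.comp Primrec.id (const 0)).of_eq fun a => by simp

theorem int_neg : Primrec fun z : ℤ => -z :=
  (int_subNatNat.comp int_toNat_neg int_toNat).of_eq fun a => by omega

theorem int_add : Primrec₂ fun a b : ℤ => a + b :=
  (int_subNatNat.comp
    (nat_add.comp (int_toNat.comp fst) (int_toNat.comp snd))
    (nat_add.comp (int_toNat_neg.comp fst) (int_toNat_neg.comp snd))).of_eq fun a => by
      beta_reduce
      omega

theorem int_mul : Primrec₂ fun a b : ℤ => a * b := by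
  have hf1 : Primrec fun p : ℤ × ℤ => p.1.toNat := int_toNat.comp fst
  have hf2 : Primrec fun p : ℤ × ℤ => (-p.1).toNat := int_toNat_neg.comp fst
  have hg1 : Primrec fun p : ℤ × ℤ => p.2.toNat := int_toNat.comp snd
  have hg2 : Primrec fun p : ℤ × ℤ => (-p.2).toNat := int_toNat_neg.comp snd
  refine (int_subNatNat.comp (nat_add.comp (nat_mul.comp hf1 hg1) (nat_mul.comp hf2 hg2))
    (nat_add.comp (nat_mul.comp hf1 hg2) (nat_mul.comp hf2 hg1))).of_eq fun a => ?_
  have h1 : a.1 = a.1.toNat - (-a.1).toNat := by omega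
  have h2 : a.2 = a.2.toNat - (-a.2).toNat := by omega
  conv_rhs => rw [h1, h2]
  push_cast
  ring

end Primrec

namespace Computable

variable {α β : Type*} [Primcodable α] [Primcodable β]

protected theorem id' : Computable fun a : α => a := Computable.id

theorem int_natCast {f : α → ℕ} (hf : Computable f) : Computable fun a => (f a : ℤ) :=
  Primrec.int_natCast.to_comp.comp hf

theorem nat_add {f g : α → ℕ} (hf : Computable f) (hg : Computable g) :
    Computable fun a => f a + g a := Primrec.nat_add.to_comp.comp hf hg

theorem nat_mul {f g : α → ℕ} (hf : Computable f) (hg : Computable g) :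
    Computable fun a => f a * g a := Primrec.nat_mul.to_comp.comp hf hg

theorem int_neg {f : α → ℤ} (hf : Computable f) : Computable fun a => -f a :=
  Primrec.int_neg.to_comp.comp hf

theorem int_add {f g : α → ℤ} (hf : Computable f) (hg : Computable g) :
    Computable fun a => f a + g a := Primrec.int_add.to_comp.comp hf hg

theorem int_sub {f g : α → ℤ} (hf : Computable f) (hg : Computable g) :
    Computable fun a => f a - g a :=
  (int_add hf (int_neg hg)).of_eq fun a => by ring

theorem int_mul {f g : α → ℤ} (hf : Computable f) (hg : Computable g) :
    Computable fun a => f a * g a := Primrec.int_mul.to_comp.comp hf hg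

theorem int_pow {f : α → ℤ} {n : α → ℕ} (hf : Computable f) (hn : Computable n) :
    Computable fun a => f a ^ n a := by
  have h : Computable₂ fun (a : α) (p : ℕ × ℤ) => p.2 * f a :=
    int_mul (snd.comp snd) (hf.comp fst)
  refine (nat_rec hn (const (1 : ℤ)) h).of_eq fun a => ?_
  induction n a with
  | zero => exact (pow_zero _).symm
  | succ k ih => simp only [pow_succ, ← ih]

theorem nat_pow {f n : α → ℕ} (hf : Computable f) (hn : Computable n) :
    Computable fun a => f a ^ n a :=
  (Primrec.int_toNat.to_comp.comp (int_pow (int_natCast hf) hn)).of_eq fun a => by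
    rw [← Nat.cast_pow, Int.toNat_natCast]

theorem int_sum_range {f : α → ℕ → ℤ} {n : α → ℕ} (hf : Computable fun p : α × ℕ => f p.1 p.2)
    (hn : Computable n) : Computable fun a => ∑ k ∈ Finset.range (n a), f a k := by
  have h : Computable₂ fun (a : α) (p : ℕ × ℤ) => p.2 + f a p.1 :=
    int_add (f := fun q : α × ℕ × ℤ => q.2.2) (g := fun q : α × ℕ × ℤ => f q.1 q.2.1)
      (snd.comp snd) (Computable₂.comp (f := f) hf fst (fst.comp snd))
  refine (nat_rec hn (const (0 : ℤ)) h).of_eq fun a => ?_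
  induction n a with
  | zero => exact Finset.sum_range_zero _ |>.symm
  | succ k ih => simp only [Finset.sum_range_succ, ← ih]

theorem list_getD' {l : α → List β} {n : α → ℕ} (hl : Computable l) (hn : Computable n) (d : β) :
    Computable fun a => (l a).getD (n a) d :=
  (Primrec.list_getD d).to_comp.comp hl hn

end Computable

/-! ### Decidable predicates and unbounded search -/

namespace ComputablePred

variable {α : Type*} [Primcodable α]

theorem and {p q : α → Prop} (hp : ComputablePred p) (hq : ComputablePred q) :
    ComputablePred fun a => p a ∧ q a := by
  obtain ⟨_, hp⟩ := hp
  obtain ⟨_, hq⟩ := hq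
  exact ⟨inferInstance, (Primrec.and.to_comp.comp hp hq).of_eq fun a => by simp⟩

theorem nat_le {f g : α → ℕ} (hf : Computable f) (hg : Computable g) :
    ComputablePred fun a => f a ≤ g a :=
  ⟨inferInstance, Primrec.nat_le.decide.to_comp.comp hf hg⟩

theorem int_le {f g : α → ℤ} (hf : Computable f) (hg : Computable g) :
    ComputablePred fun a => f a ≤ g a :=
  (nat_le (Primrec.int_toNat.to_comp.comp (hf.int_sub hg)) (Computable.const 0)).of_eq
    fun a => by omega

theorem int_lt {f g : α → ℤ} (hf : Computable f) (hg : Computable g) :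
    ComputablePred fun a => f a < g a :=
  (int_le (hf.int_add (Computable.const 1)) hg).of_eq fun a => by omega

theorem int_eq {f g : α → ℤ} (hf : Computable f) (hg : Computable g) :
    ComputablePred fun a => f a = g a :=
  ((int_le hf hg).and (int_le hg hf)).of_eq fun a => by omega

theorem forall_lt {p : α → ℕ → Prop} {n : α → ℕ}
    (hp : ComputablePred fun q : α × ℕ => p q.1 q.2) (hn : Computable n) :
    ComputablePred fun a => ∀ k < n a, p a k := by
  classical
  obtain ⟨_, hp⟩ := hp
  have h : Computable₂ fun (a : α) (q : ℕ × Bool) => q.2 && decide (p a q.1) :=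
    (Primrec.and.to_comp.comp (Computable.snd.comp Computable.snd)
      (hp.comp (Computable.pair Computable.fst (Computable.fst.comp Computable.snd)))).of_eq
      fun a => by congr
  refine ⟨inferInstance, (Computable.nat_rec hn (Computable.const true) h).of_eq fun a => ?_⟩
  have key : ∀ N : ℕ, (Nat.rec true (fun k b => b && decide (p a k)) N : Bool) =
      decide (∀ k < N, p a k) := by
    intro N
    induction N with
    | zero => simp
    | succ k ih =>
      simp only [ih, Nat.lt_succ_iff_lt_or_eq, or_imp, forall_and, forall_eq, Bool.decide_and]
  exact (key (n a)).trans (by congr)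

end ComputablePred

/-- Unbounded search: if a decidable relation is total, then it has a computable choice
function. -/
theorem ComputablePred.exists_computable {α β : Type*} [Primcodable α] [Primcodable β]
    {p : α → β → Prop} (hp : ComputablePred fun q : α × β => p q.1 q.2) (h : ∀ a, ∃ b, p a b) :
    ∃ f : α → β, Computable f ∧ ∀ a, p a (f a) := by
  classical
  obtain ⟨_, hp⟩ := hp
  -- `F a n` tests the candidate with code `n`; a number that codes nothing, or a bad candidate,
  -- gives `none`, so the search passes over it.
  let F : α → ℕ → Option β := fun a n =>
    (Encodable.decode (α := β) n).bind fun b => cond (decide (p a b)) (some b) none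
  have hF : Computable₂ F := by
    refine Computable.option_bind (Computable.decode.comp Computable.snd) ?_
    refine Computable.cond ?_ (Computable.option_some.comp Computable.snd) (Computable.const none)
    exact (hp.comp (Computable.pair (Computable.fst.comp Computable.fst) Computable.snd)).of_eq
      fun a => by congr
  have hFp : ∀ a n b, b ∈ F a n → p a b := by
    intro a n b hb
    simp only [F, Option.mem_def, Option.bind_eq_some_iff] at hb
    obtain ⟨b', -, hb'⟩ := hb
    by_cases hab : p a b'
    · simp only [hab, decide_true, cond_true, Option.some.injEq] at hb'
      exact hb' ▸ hab
    · simp [hab] at hb'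
  have hdom : ∀ a, (Nat.rfindOpt (F a)).Dom := by
    intro a
    obtain ⟨b, hb⟩ := h a
    exact Nat.rfindOpt_dom.2 ⟨Encodable.encode b, b, by simp [F, hb]⟩
  refine ⟨fun a => (Nat.rfindOpt (F a)).get (hdom a),
    (Partrec.rfindOpt hF).of_eq_tot fun a => Part.get_mem _, fun a => ?_⟩
  obtain ⟨n, hn⟩ := Nat.rfindOpt_spec (Part.get_mem (hdom a))
  exact hFp a n _ hn

/-! ### Projections with Gaussian rational entries -/

/-- The subfield `ℚ(i)` of the complex numbers. -/
def gaussianRationals : Subfield ℂ where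
  carrier := {z | ∃ a b : ℚ, z = a + b * Complex.I}
  zero_mem' := ⟨0, 0, by simp⟩
  one_mem' := ⟨1, 0, by simp⟩
  add_mem' := by
    rintro _ _ ⟨a, b, rfl⟩ ⟨c, d, rfl⟩
    exact ⟨a + c, b + d, by push_cast; ring⟩
  neg_mem' := by
    rintro _ ⟨a, b, rfl⟩
    exact ⟨-a, -b, by push_cast; ring⟩
  mul_mem' := by
    rintro _ _ ⟨a, b, rfl⟩ ⟨c, d, rfl⟩
    refine ⟨a * c - b * d, a * d + b * c, ?_⟩
    push_cast
    linear_combination (b * d : ℂ) * Complex.I_mul_I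
  inv_mem' := by
    rintro _ ⟨a, b, rfl⟩
    refine ⟨a / (a ^ 2 + b ^ 2), -b / (a ^ 2 + b ^ 2), ?_⟩
    apply Complex.ext <;> simp [Complex.normSq_apply, ← sq, ← Rat.cast_pow, ← Rat.cast_add,
      ← Rat.cast_div, ← Rat.cast_neg]

theorem mem_gaussianRationals {z : ℂ} :
    z ∈ gaussianRationals ↔ ∃ a b : ℚ, z = a + b * Complex.I := Iff.rfl

theorem star_mem_gaussianRationals {z : ℂ} (hz : z ∈ gaussianRationals) :
    star z ∈ gaussianRationals := by
  obtain ⟨a, b, rfl⟩ := hz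
  exact ⟨a, -b, by simp⟩

theorem dense_gaussianRationals : Dense (gaussianRationals : Set ℂ) := by
  rw [Metric.dense_iff]
  intro z r hr
  obtain ⟨a, ha⟩ := exists_rat_near z.re (half_pos hr)
  obtain ⟨b, hb⟩ := exists_rat_near z.im (half_pos hr)
  refine ⟨a + b * Complex.I, ?_, a, b, rfl⟩
  rw [Metric.mem_ball, dist_comm, dist_eq_norm]
  refine (Complex.norm_le_abs_re_add_abs_im _).trans_lt ?_
  simp
  linarith

theorem ContinuousAt.matrix_mul_mul_conjTranspose {ι κ : Type*} [Fintype κ]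
    {M : Matrix ι κ ℂ → Matrix κ κ ℂ}
    {W : Matrix ι κ ℂ} (hM : ContinuousAt M W) :
    ContinuousAt (fun W => W * M W * W.conjTranspose) W := by
  have h : Continuous fun p : Matrix ι κ ℂ × Matrix κ κ ℂ => p.1 * p.2 * p.1.conjTranspose := by
    fun_prop
  exact ContinuousAt.comp (f := fun W => (W, M W)) h.continuousAt (continuousAt_id.prodMk hM)

namespace Matrix

variable {ι κ : Type*} [Fintype ι] [Fintype κ]

theorem det_mem_subfield [DecidableEq ι] {K : Subfield ℂ} {A : Matrix ι ι ℂ}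
    (hA : ∀ i j, A i j ∈ K) : A.det ∈ K := by
  rw [det_apply]
  exact K.sum_mem fun σ _ => by
    rw [Units.smul_def]
    exact K.zsmul_mem (K.prod_mem fun i _ => hA _ _) _

theorem inv_mem_subfield [DecidableEq ι] {K : Subfield ℂ} {A : Matrix ι ι ℂ}
    (hA : ∀ i j, A i j ∈ K) (i j : ι) : A⁻¹ i j ∈ K := by
  rw [inv_def, smul_apply, Ring.inverse_eq_inv', smul_eq_mul, adjugate_apply]
  refine K.mul_mem (K.inv_mem (det_mem_subfield hA)) (det_mem_subfield fun k l => ?_)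
  rw [updateRow_apply]
  split_ifs
  · rw [Pi.single_apply]
    split_ifs
    exacts [K.one_mem, K.zero_mem]
  · exact hA _ _

theorem mul_mem_subfield {μ : Type*} {K : Subfield ℂ} {A : Matrix μ ι ℂ} {ν : Type*}
    {B : Matrix ι ν ℂ} (hA : ∀ i j, A i j ∈ K) (hB : ∀ i j, B i j ∈ K) (i : μ) (j : ν) :
    (A * B) i j ∈ K := by
  rw [mul_apply]
  exact K.sum_mem fun k _ => K.mul_mem (hA _ _) (hB _ _)

variable [DecidableEq κ]

/-- The orthogonal projection onto the column space of a matrix of full column rank. -/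
noncomputable def columnProjection (W : Matrix ι κ ℂ) : Matrix ι ι ℂ := W * (Wᴴ * W)⁻¹ * Wᴴ

theorem isStarProjection_columnProjection {W : Matrix ι κ ℂ} (hW : (Wᴴ * W).det ≠ 0) :
    IsStarProjection (columnProjection W) where
  isIdempotentElem := by
    have h : (Wᴴ * W)⁻¹ * (Wᴴ * W) = 1 := nonsing_inv_mul _ (isUnit_iff_ne_zero.2 hW)
    calc columnProjection W * columnProjection W
        = W * ((Wᴴ * W)⁻¹ * (Wᴴ * W)) * (Wᴴ * W)⁻¹ * Wᴴ := by
          simp only [columnProjection, Matrix.mul_assoc]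
      _ = columnProjection W := by rw [h, Matrix.mul_one, columnProjection]
  isSelfAdjoint := by
    rw [IsSelfAdjoint, star_eq_conjTranspose, columnProjection]
    simp [conjTranspose_mul, conjTranspose_nonsing_inv, Matrix.mul_assoc]

/-- By cyclicity this is the trace of an identity matrix. Hence perturbing `W` leaves the trace
exactly unchanged. -/
theorem trace_columnProjection {W : Matrix ι κ ℂ} (hW : (Wᴴ * W).det ≠ 0) :
    (columnProjection W).trace = Fintype.card κ := by
  rw [columnProjection, Matrix.mul_assoc, trace_mul_comm, Matrix.mul_assoc,
    nonsing_inv_mul _ (isUnit_iff_ne_zero.2 hW), trace_one]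

theorem continuousAt_columnProjection {W : Matrix ι κ ℂ} (hW : (Wᴴ * W).det ≠ 0) :
    ContinuousAt (columnProjection : Matrix ι κ ℂ → Matrix ι ι ℂ) W := by
  refine ContinuousAt.matrix_mul_mul_conjTranspose (M := fun W : Matrix ι κ ℂ => (Wᴴ * W)⁻¹) ?_
  have h1 : Continuous fun W : Matrix ι κ ℂ => Wᴴ * W := by fun_prop
  have h2 : ContinuousAt (fun W : Matrix ι κ ℂ => (Wᴴ * W).det) W := h1.matrix_det.continuousAt
  have h3 : ContinuousAt (fun W : Matrix ι κ ℂ => ((Wᴴ * W).det)⁻¹) W := h2.inv₀ hW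
  have h4 : ContinuousAt (fun W : Matrix ι κ ℂ => (Wᴴ * W).adjugate) W :=
    h1.matrix_adjugate.continuousAt
  refine (h3.smul h4).congr (Eventually.of_forall fun W => ?_)
  beta_reduce
  rw [inv_def, Ring.inverse_eq_inv']
  rfl

/-- A projection can be approximated, with respect to a linear functional, by projections of the
same rank with Gaussian rational entries. -/
theorem exists_gaussianRational_projection (ρ : Matrix ι ι ℂ) {V : Matrix ι κ ℂ}
    (hV : Vᴴ * V = 1) {δ : ℝ} (hδ : δ < ((ρ * (V * Vᴴ)).trace).re) :
    ∃ P : Matrix ι ι ℂ, IsStarProjection P ∧ P.trace = Fintype.card κ ∧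
      δ < ((ρ * P).trace).re ∧ ∀ i j, P i j ∈ gaussianRationals := by
  have hV0 : (Vᴴ * V).det ≠ 0 := by simp [hV]
  have h1 : ContinuousAt (fun W : Matrix ι κ ℂ => ((ρ * columnProjection W).trace).re) V := by
    have : Continuous fun P : Matrix ι ι ℂ => ((ρ * P).trace).re := by fun_prop
    exact this.continuousAt.comp (continuousAt_columnProjection hV0)
  have h2 : Continuous fun W : Matrix ι κ ℂ => (Wᴴ * W).det := by fun_prop
  have hδ' : δ < ((ρ * columnProjection V).trace).re := by simpa [columnProjection, hV] using hδ
  -- The isometry is perturbed rather than the projection: full column rank and large mass are open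
  -- conditions on `W`, whereas idempotence is not open.
  have hev : ∀ᶠ W in 𝓝 V, δ < ((ρ * columnProjection W).trace).re ∧ (Wᴴ * W).det ≠ 0 :=
    (h1.eventually (lt_mem_nhds hδ')).and (h2.continuousAt.eventually_ne hV0)
  have hd : Dense {W : Matrix ι κ ℂ | ∀ i j, W i j ∈ gaussianRationals} := by
    have h : Dense (Set.pi Set.univ fun _ : ι => Set.pi Set.univ fun _ : κ =>
        (gaussianRationals : Set ℂ)) :=
      dense_pi _ fun _ _ => dense_pi _ fun _ _ => dense_gaussianRationals
    have h' : Dense {W : ι → κ → ℂ | ∀ i j, W i j ∈ gaussianRationals} :=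
      h.mono fun W (hW : ∀ i, _ → ∀ j, _ → W i j ∈ gaussianRationals) i j => hW i trivial j trivial
    exact h'
  obtain ⟨W, hW, hW1, hW2⟩ := (hd.inter_nhds_nonempty hev)
  have hWs : ∀ i j, Wᴴ i j ∈ gaussianRationals := fun i j => star_mem_gaussianRationals (hW j i)
  exact ⟨columnProjection W, isStarProjection_columnProjection hW2, trace_columnProjection hW2,
    hW1, mul_mem_subfield (mul_mem_subfield hW (inv_mem_subfield (mul_mem_subfield hWs hW))) hWs⟩

end Matrix

/-! ### Entropy and the mass of the leading eigenvectors -/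

/-- The Shannon entropy of a distribution on `2 ^ n` points is at most `n`. -/
theorem neg_sum_mul_logb_le {ι : Type*} [Fintype ι] {n : ℕ} (hι : Fintype.card ι = 2 ^ n)
    {α : ι → ℝ} (h0 : ∀ i, 0 ≤ α i) (h1 : ∑ i, α i = 1) :
    -∑ i, α i * Real.logb 2 (α i) ≤ n := by
  have hl : (0 : ℝ) < Real.log 2 := Real.log_pos one_lt_two
  -- Gibbs' inequality: `log x ≤ x - 1` at `x = 2⁻ⁿ / α i`, multiplied by `α i`. The right-hand
  -- sides sum to zero.
  have key : ∀ i, -(α i * Real.log (α i)) - n * Real.log 2 * α i ≤ ((2 : ℝ) ^ n)⁻¹ - α i := by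
    intro i
    rcases (h0 i).eq_or_lt with h | h
    · simp [← h]
    · have h2 : (0 : ℝ) < ((2 : ℝ) ^ n)⁻¹ / α i := by positivity
      have h3 := mul_le_mul_of_nonneg_left (Real.log_le_sub_one_of_pos h2) h.le
      rw [Real.log_div (by positivity) h.ne', Real.log_inv, Real.log_pow, mul_sub, mul_sub,
        mul_div_cancel₀ _ h.ne'] at h3
      linarith
  have hsum := Finset.sum_le_sum fun i (_ : i ∈ Finset.univ) => key i
  simp only [Finset.sum_sub_distrib, ← Finset.mul_sum, h1, Finset.sum_neg_distrib,
    Finset.sum_const, Finset.card_univ, hι, nsmul_eq_mul, Nat.cast_pow, Nat.cast_ofNat] at hsum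
  rw [mul_inv_cancel₀ (by positivity)] at hsum
  simp only [Real.logb, mul_div_assoc', ← Finset.sum_div]
  rw [← neg_div, div_le_iff₀ hl]
  linarith

/-- If the entropy of a distribution is small, then few points carry a large part of it. -/
theorem exists_finset_of_entropy_le {ι : Type*} [Fintype ι] {α : ι → ℝ} (h0 : ∀ i, 0 ≤ α i)
    (h1 : ∑ i, α i = 1) {b s : ℝ} (hb : 0 < b) (hs : -∑ i, α i * Real.logb 2 (α i) ≤ s) :
    ∃ S : Finset ι, (S.card : ℝ) ≤ 2 ^ b ∧ 1 - s / b ≤ ∑ i ∈ S, α i := by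
  classical
  have hα1 : ∀ i, α i ≤ 1 := fun i =>
    h1 ▸ Finset.single_le_sum (fun j _ => h0 j) (Finset.mem_univ i)
  refine ⟨Finset.univ.filter fun i => (2 : ℝ) ^ (-b) ≤ α i, ?_, ?_⟩
  · have h2 : ∑ i ∈ Finset.univ.filter (fun i => (2 : ℝ) ^ (-b) ≤ α i), (2 : ℝ) ^ (-b) ≤ 1 :=
      h1 ▸ (Finset.sum_le_sum fun i hi => (Finset.mem_filter.1 hi).2).trans
        (Finset.sum_le_univ_sum_of_nonneg h0)
    rw [Finset.sum_const, nsmul_eq_mul] at h2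
    have h3 : (2 : ℝ) ^ (-b) * 2 ^ b = 1 := by rw [← Real.rpow_add two_pos]; simp
    have h4 := mul_le_mul_of_nonneg_right h2 (Real.rpow_nonneg zero_le_two b)
    rwa [mul_assoc, h3, mul_one, one_mul] at h4
  -- Markov's inequality: a point outside the set contributes at least `α i * b` to the entropy, and
  -- a point inside contributes at least 0 because `α i ≤ 1`.
  · have h3 : ∑ i, (if (2 : ℝ) ^ (-b) ≤ α i then 0 else α i * b) ≤
        ∑ i, -(α i * Real.logb 2 (α i)) := by
      refine Finset.sum_le_sum fun i _ => ?_
      split_ifs with h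
      · rw [← mul_neg]
        exact mul_nonneg (h0 i) (neg_nonneg.2 (Real.logb_nonpos one_lt_two (h0 i) (hα1 i)))
      · rw [← mul_neg]
        rcases (h0 i).eq_or_lt with h' | h'
        · simp [← h']
        · refine mul_le_mul_of_nonneg_left (le_neg.2 ?_) (h0 i)
          exact (Real.logb_le_iff_le_rpow one_lt_two h').2 (not_le.1 h).le
    have h4 : ∑ i, (if (2 : ℝ) ^ (-b) ≤ α i then 0 else α i * b) =
        (1 - ∑ i ∈ Finset.univ.filter (fun i => (2 : ℝ) ^ (-b) ≤ α i), α i) * b := by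
      rw [← h1, Finset.sum_filter, ← Finset.sum_sub_distrib, Finset.sum_mul]
      refine Finset.sum_congr rfl fun i _ => ?_
      split_ifs <;> ring
    rw [h4, Finset.sum_neg_distrib] at h3
    rw [sub_le_comm, le_div_iff₀ hb]
    exact h3.trans hs

namespace Matrix.IsHermitian

variable {ι : Type*} [Fintype ι] [DecidableEq ι] {d : Matrix ι ι ℂ}

/-- The isometry whose columns are the eigenvectors with index in `S`. -/
theorem exists_isometry_trace_eq_sum_eigenvalues (hd : d.IsHermitian) (S : Finset ι) :
    ∃ V : Matrix ι S ℂ, Vᴴ * V = 1 ∧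
      ((d * (V * Vᴴ)).trace).re = ∑ i ∈ S, hd.eigenvalues i := by
  let U : Matrix ι ι ℂ := hd.eigenvectorUnitary
  let V : Matrix ι S ℂ := U.submatrix id Subtype.val
  have hU : Uᴴ * U = 1 := Unitary.coe_star_mul_self hd.eigenvectorUnitary
  -- Used twice: `A = 1` shows that `V` is an isometry, and `A = d` gives the trace.
  have hV : ∀ A : Matrix ι ι ℂ, Vᴴ * A * V = (Uᴴ * A * U).submatrix Subtype.val Subtype.val := by
    intro A
    ext i j
    simp [V, mul_apply]
  have hdiag : Uᴴ * d * U = diagonal (RCLike.ofReal ∘ hd.eigenvalues) := by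
    have h := hd.conjStarAlgAut_star_eigenvectorUnitary
    rwa [Unitary.conjStarAlgAut_star_apply] at h
  refine ⟨V, ?_, ?_⟩
  · have h := hV 1
    rw [Matrix.mul_one, Matrix.mul_one, hU] at h
    rw [h]
    exact submatrix_one _ Subtype.val_injective
  · rw [← Matrix.mul_assoc, trace_mul_comm, ← Matrix.mul_assoc, hV, hdiag]
    simp only [trace, diag_apply, submatrix_apply, diagonal_apply_eq, Function.comp_apply,
      Complex.re_sum]
    exact Finset.sum_coe_sort S fun i => hd.eigenvalues i

end Matrix.IsHermitian

/-! ### Projections of small trace and large mass from low entropy -/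

namespace QuantumRandomness

theorem IsDensityMatrix.eigenvalues_nonneg {ι : Type*} [Fintype ι] [DecidableEq ι]
    {d : Matrix ι ι ℂ} (hd : IsDensityMatrix d) (i : ι) :
    0 ≤ hd.posSemidef.isHermitian.eigenvalues i := hd.posSemidef.eigenvalues_nonneg i

theorem IsDensityMatrix.sum_eigenvalues {ι : Type*} [Fintype ι] [DecidableEq ι]
    {d : Matrix ι ι ℂ} (hd : IsDensityMatrix d) :
    ∑ i, hd.posSemidef.isHermitian.eigenvalues i = 1 := by
  have h := hd.posSemidef.isHermitian.trace_eq_sum_eigenvalues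
  rw [hd.trace_eq_one] at h
  have h' := congrArg Complex.re h
  simpa using h'.symm

theorem QState.entropy_le (ρ : QState) (n : ℕ) : ρ.entropy n ≤ n :=
  neg_sum_mul_logb_le (by simp) (ρ.density n).eigenvalues_nonneg (ρ.density n).sum_eigenvalues

/-- If the entropy rate of `ρ` does not tend to one, then some `δ > 0` is such that `ρ` gives mass
more than `δ` to rational projections of arbitrarily small tracial measure. -/
theorem QState.exists_projections_of_not_tendsto (ρ : QState)
    (h : ¬ Tendsto (fun n : ℕ => ρ.entropy n / (n : ℝ)) atTop (𝓝 1)) :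
    ∃ δ : ℝ, 0 < δ ∧ ∀ m : ℕ, ∃ n, 1 ≤ n ∧ ∃ P : Matrix (Fin (2 ^ n)) (Fin (2 ^ n)) ℂ,
      IsStarProjection P ∧ 2 ^ m * P.trace = 2 ^ n ∧ δ < ρ.measure P ∧
      ∀ i j, P i j ∈ gaussianRationals := by
  have h1 : ∀ n : ℕ, ρ.entropy n / n ≤ 1 := fun n => by
    rcases n.eq_zero_or_pos with rfl | hn
    · simp
    · exact (div_le_one (by exact_mod_cast hn)).2 (ρ.entropy_le n)
  obtain ⟨a, ha0, ha1, hfr⟩ : ∃ a : ℝ, 0 ≤ a ∧ a < 1 ∧ ∃ᶠ n : ℕ in atTop,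
      ρ.entropy n / n ≤ a := by
    by_contra! hcon
    refine h (tendsto_order.2 ⟨fun a ha => ?_, fun a ha => Eventually.of_forall fun n =>
      (h1 n).trans_lt ha⟩)
    exact (hcon (max a 0) (le_max_right _ _) (max_lt ha one_pos)).mono fun n hn =>
      (le_max_left a 0).trans_lt hn
  obtain ⟨b, hab, hb1⟩ := exists_between ha1
  have hb0 : 0 < b := ha0.trans_lt hab
  have hδ : 0 < 1 - a / b := sub_pos.2 ((div_lt_one hb0).2 hab)
  -- Halving the mass `1 - a / b` provides the strict inequality needed for the rational
  -- perturbation.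
  refine ⟨(1 - a / b) / 2, half_pos hδ, fun m => ?_⟩
  -- The bound `n ≥ m / (1 - b)` is chosen to give `b * n ≤ n - m`.
  obtain ⟨n, hna, hn1, hnm⟩ := (hfr.and_eventually ((eventually_ge_atTop 1).and
    (tendsto_natCast_atTop_atTop.eventually_ge_atTop (m / (1 - b))))).exists
  have hn0 : (0 : ℝ) < n := by exact_mod_cast hn1
  rw [div_le_iff₀ (sub_pos.2 hb1)] at hnm
  rw [div_le_iff₀ hn0] at hna
  have hmn : m ≤ n := by
    have : (m : ℝ) ≤ n := by nlinarith
    exact_mod_cast this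
  have hH := (ρ.density n).posSemidef.isHermitian
  obtain ⟨S, hS, hSρ⟩ := exists_finset_of_entropy_le (ρ.density n).eigenvalues_nonneg
    (ρ.density n).sum_eigenvalues (mul_pos hb0 hn0) hna
  have hScard : S.card ≤ 2 ^ (n - m) := by
    have h2 : (2 : ℝ) ^ (b * n) ≤ 2 ^ (((n - m : ℕ) : ℝ)) := by
      refine Real.rpow_le_rpow_of_exponent_le one_le_two ?_
      rw [Nat.cast_sub hmn]
      linarith
    rw [Real.rpow_natCast] at h2
    exact_mod_cast hS.trans h2
  -- Padding to exactly `2 ^ (n - m)` eigenvectors loses no mass and makes the normalized trace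
  -- exactly `2 ^ (-m)`.
  obtain ⟨T, hST, hT⟩ := Finset.exists_superset_card_eq hScard
    (by simpa using Nat.pow_le_pow_right two_pos (Nat.sub_le n m))
  rw [mul_div_mul_right _ _ hn0.ne'] at hSρ
  have hTρ : 1 - a / b ≤ ∑ i ∈ T, hH.eigenvalues i :=
    hSρ.trans (Finset.sum_le_sum_of_subset_of_nonneg hST fun i _ _ =>
      (ρ.density n).eigenvalues_nonneg i)
  obtain ⟨V, hV, hVρ⟩ := hH.exists_isometry_trace_eq_sum_eigenvalues T
  obtain ⟨P, hP, hPt, hPρ, hPr⟩ := Matrix.exists_gaussianRational_projection (ρ.mat n) hV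
    (δ := (1 - a / b) / 2) (by rw [hVρ]; linarith)
  refine ⟨n, hn1, P, hP, ?_, hPρ, hPr⟩
  rw [hPt, Fintype.card_coe, hT, Nat.cast_pow, Nat.cast_ofNat, ← pow_add, Nat.add_sub_cancel' hmn]

end QuantumRandomness

/-! ### Certified approximations of algebraic numbers -/

namespace QuantumRandomness

open Polynomial

theorem degree_polyOfList_lt (l : List ℤ) : (polyOfList l).degree < l.length := by
  induction l with
  | nil => simp [polyOfList]
  | cons a l ih =>
    rw [polyOfList, List.length_cons]
    refine (degree_add_le _ _).trans_lt (max_lt ?_ ?_)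
    · exact degree_C_le.trans_lt (by exact_mod_cast Nat.succ_pos _)
    · rcases eq_or_ne (polyOfList l) 0 with h | h
      · simp [h]
      · rw [degree_mul, degree_X, degree_eq_natDegree h] at *
        have : (polyOfList l).natDegree < l.length := by exact_mod_cast ih
        exact_mod_cast (by omega : 1 + (polyOfList l).natDegree < l.length + 1)

/-- If an integer polynomial is small at `z`, then it has a complex root close to `z`. -/
theorem exists_root_near {p : ℤ[X]} (hp : p ≠ 0) {L : ℕ} (hL : p.degree < L) {z : ℂ} {K : ℝ}
    (hK : 1 < K) (h : ‖aeval z p‖ * K ^ L ≤ 1) : ∃ w : ℂ, aeval w p = 0 ∧ ‖z - w‖ ≤ K⁻¹ := by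
  by_contra! hcon
  have hK0 : 0 < K := one_pos.trans hK
  set q : ℂ[X] := p.map (Int.castRingHom ℂ) with hq
  have hinj : Function.Injective (Int.castRingHom ℂ) := Int.cast_injective
  have hq0 : q ≠ 0 := (Polynomial.map_ne_zero_iff hinj).2 hp
  have hev : ∀ w, aeval w p = q.eval w := fun w => by
    rw [hq, eval_map, aeval_def]
    rfl
  -- If all roots were farther than `K⁻¹` from `z`, factoring `p` over `ℂ` would bound `‖p(z)‖`
  -- below by `K⁻¹ ^ deg p`, since the leading coefficient is a nonzero integer and so has modulus
  -- at least 1.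
  have hprod : ∀ s : Multiset ℂ, (∀ w ∈ s, K⁻¹ ≤ ‖z - w‖) →
      K⁻¹ ^ s.card ≤ ‖(s.map (z - ·)).prod‖ := by
    intro s
    induction s using Multiset.induction with
    | empty => simp
    | cons a s ih =>
      intro hs
      rw [Multiset.card_cons, Multiset.map_cons, Multiset.prod_cons, norm_mul, pow_succ']
      exact mul_le_mul (hs a (Multiset.mem_cons_self a s))
        (ih fun w hw => hs w (Multiset.mem_cons_of_mem hw)) (by positivity) (norm_nonneg _)
  have hspl : q.Splits := IsAlgClosed.splits q
  have h1 := hprod q.roots fun w hw => (hcon w (by rw [hev]; exact (mem_roots hq0).1 hw)).le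
  have h2 : ‖aeval z p‖ = ‖q.leadingCoeff‖ * ‖(q.roots.map (z - ·)).prod‖ := by
    rw [hev, hspl.eval_eq_prod_roots, norm_mul]
  have h3 : 1 ≤ ‖q.leadingCoeff‖ := by
    rw [hq, leadingCoeff_map_of_injective hinj, eq_intCast, Complex.norm_intCast]
    exact_mod_cast Int.one_le_abs (leadingCoeff_ne_zero.2 hp)
  have h4 : q.roots.card < L := by
    rw [← hspl.natDegree_eq_card_roots, hq, natDegree_map_eq_of_injective hinj]
    exact (natDegree_lt_iff_degree_lt hp).2 hL
  have h5 : K⁻¹ ^ L < K⁻¹ ^ q.roots.card :=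
    pow_lt_pow_right_of_lt_one₀ (by positivity) (inv_lt_one_of_one_lt₀ hK) h4
  have h6 : K⁻¹ ^ L < ‖aeval z p‖ := by
    rw [h2]
    nlinarith [norm_nonneg (q.roots.map (z - ·)).prod]
  have h7 : K⁻¹ ^ L * K ^ L = 1 := by rw [← mul_pow, inv_mul_cancel₀ hK0.ne', one_pow]
  nlinarith [mul_lt_mul_of_pos_right h6 (pow_pos hK0 L)]

/-- A verifiable condition which guarantees that `z` approximates the number with code `c` up to
`1 / (k + 1)`. -/
def AlgCode.Certifies (c : AlgCode) (z : ℂ) (k : ℕ) : Prop :=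
  ‖aeval z (polyOfList c.1)‖ * ((k : ℝ) + 1) ^ c.1.length ≤ 1 ∧
    ‖z - c.center‖ + 1 / ((k : ℝ) + 1) < (c.2.2.2.val : ℝ)

/-- The small value gives some root within `1 / (k + 1)` of `z`; the margin in the second condition
places this root in the disc, where `w` is the only one. -/
theorem AlgCode.Represents.norm_sub_le {c : AlgCode} {w z : ℂ} {k : ℕ} (hc : c.Represents w)
    (hz : c.Certifies z k) (hk : 0 < k) : ‖w - z‖ ≤ 1 / ((k : ℝ) + 1) := by
  have hk' : (1 : ℝ) < k + 1 := by
    have : (0 : ℝ) < k := by exact_mod_cast hk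
    linarith
  obtain ⟨v, hv, hvz⟩ := exists_root_near hc.1 (degree_polyOfList_lt _) hk' hz.1
  rw [← one_div] at hvz
  have hvc : v ∈ c.disc := by
    rw [AlgCode.disc, Metric.mem_ball, dist_eq_norm]
    have h1 : ‖v - c.center‖ ≤ ‖z - v‖ + ‖z - c.center‖ := by
      rw [norm_sub_rev z v]
      exact norm_sub_le_norm_sub_add_norm_sub _ _ _
    have h2 := hz.2
    linarith
  rw [← (hc.2 v).1 ⟨hvc, hv⟩, norm_sub_rev]
  exact hvz

/-- Since `w` lies in an open disc, a large `k` leaves room there. For such a fixed `k` both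
conditions hold strictly at `w`, hence near `w` by continuity; so `k` must be chosen before `z`. -/
theorem AlgCode.Represents.eventually_certifies {c : AlgCode} {w : ℂ} (hc : c.Represents w) :
    ∀ᶠ k : ℕ in atTop, ∀ᶠ z in 𝓝 w, c.Certifies z k := by
  obtain ⟨hw, hw0⟩ := (hc.2 w).2 rfl
  rw [AlgCode.disc, Metric.mem_ball, dist_eq_norm] at hw
  have hlim : Tendsto (fun k : ℕ => ‖w - c.center‖ + 1 / ((k : ℝ) + 1)) atTop
      (𝓝 (‖w - c.center‖ + 0)) := tendsto_one_div_add_atTop_nhds_zero_nat.const_add _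
  rw [add_zero] at hlim
  filter_upwards [hlim.eventually (gt_mem_nhds hw)] with k hk
  have h1 : Continuous fun z : ℂ => ‖aeval z (polyOfList c.1)‖ * ((k : ℝ) + 1) ^ c.1.length :=
    ((polyOfList c.1).continuous_aeval).norm.mul continuous_const
  have h2 : Continuous fun z : ℂ => ‖z - c.center‖ + 1 / ((k : ℝ) + 1) := by fun_prop
  refine (h1.continuousAt.eventually (gt_mem_nhds ?_)).mono (fun _ => le_of_lt) |>.and
    (h2.continuousAt.eventually (gt_mem_nhds hk))
  simp [hw0]

/-- The complex number `(x + y i) / (d + 1)`. -/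
noncomputable def gaussianFrac (x y : ℤ) (d : ℕ) : ℂ := (x + y * Complex.I) / (d + 1)

theorem gaussianFrac_eq_mk (x y : ℤ) (d : ℕ) :
    gaussianFrac x y d = ⟨x / (d + 1), y / (d + 1)⟩ := by
  have h : (d + 1 : ℂ) = ((d + 1 : ℝ) : ℂ) := by simp
  apply Complex.ext <;> rw [gaussianFrac, h]
  · rw [Complex.div_ofReal_re]; simp
  · rw [Complex.div_ofReal_im]; simp

@[simp]
theorem gaussianFrac_re (x y : ℤ) (d : ℕ) : (gaussianFrac x y d).re = x / (d + 1) := by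
  rw [gaussianFrac_eq_mk]

@[simp]
theorem gaussianFrac_im (x y : ℤ) (d : ℕ) : (gaussianFrac x y d).im = y / (d + 1) := by
  rw [gaussianFrac_eq_mk]

/-- Homogeneous Horner scheme: for a list of coefficients of length `L`, the real and the imaginary
part of `(d + 1) ^ L` times the value of the polynomial at `(x + y i) / (d + 1)`, and
`(d + 1) ^ L`. -/
def horner (x y : ℤ) (d : ℕ) (l : List ℤ) : ℤ × ℤ × ℤ :=
  l.foldr (fun a q => (a * (d + 1) * q.2.2 + (x * q.1 + -(y * q.2.1)), x * q.2.1 + y * q.1,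
    (d + 1) * q.2.2)) (0, 0, 1)

theorem horner_snd_snd (x y : ℤ) (d : ℕ) (l : List ℤ) :
    (horner x y d l).2.2 = (d + 1 : ℤ) ^ l.length := by
  induction l with
  | nil => rfl
  | cons a l ih =>
    rw [List.length_cons, pow_succ', ← ih]
    rfl

theorem aeval_polyOfList_mul (x y : ℤ) (d : ℕ) (l : List ℤ) :
    aeval (gaussianFrac x y d) (polyOfList l) * (d + 1) ^ l.length =
      (horner x y d l).1 + (horner x y d l).2.1 * Complex.I := by
  have hd : (d + 1 : ℂ) ≠ 0 := Nat.cast_add_one_ne_zero d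
  induction l with
  | nil => simp [polyOfList, horner]
  | cons a l ih =>
    have h1 : (horner x y d (a :: l)).1 = a * (d + 1) * (horner x y d l).2.2 +
      (x * (horner x y d l).1 + -(y * (horner x y d l).2.1)) := rfl
    have h2 : (horner x y d (a :: l)).2.1 =
      x * (horner x y d l).2.1 + y * (horner x y d l).1 := rfl
    have h3 : gaussianFrac x y d * (d + 1) = x + y * Complex.I := div_mul_cancel₀ _ hd
    rw [h1, h2, horner_snd_snd, polyOfList, List.length_cons]
    simp only [map_add, map_mul, aeval_X, eq_intCast, map_intCast]
    push_cast
    rw [pow_succ']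
    linear_combination (gaussianFrac x y d * (d + 1)) * ih +
      ((horner x y d l).1 + (horner x y d l).2.1 * Complex.I) * h3 +
      y * (horner x y d l).2.1 * Complex.I_mul_I

/-- Clearing denominators and squaring norms leaves only integers. Squaring the disc inequality is
reversible only if its right-hand side is positive, whence the middle conjunct. -/
theorem AlgCode.certifies_iff (c : AlgCode) (x y : ℤ) (d k : ℕ) :
    c.Certifies (gaussianFrac x y d) k ↔
      ((horner x y d c.1).1 ^ 2 + (horner x y d c.1).2.1 ^ 2) * ((k + 1 : ℤ) ^ c.1.length) ^ 2 ≤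
        (horner x y d c.1).2.2 ^ 2 ∧
      0 < (c.2.2.2.1 * (k + 1) - (c.2.2.2.2 + 1)) * ((d + 1) * (c.2.1.2 + 1) * (c.2.2.1.2 + 1)) ∧
      ((x * (c.2.1.2 + 1) - c.2.1.1 * (d + 1)) *
          ((k + 1) * (c.2.2.1.2 + 1) * (c.2.2.2.2 + 1))) ^ 2 +
        ((y * (c.2.2.1.2 + 1) - c.2.2.1.1 * (d + 1)) *
          ((k + 1) * (c.2.1.2 + 1) * (c.2.2.2.2 + 1))) ^ 2 <
        ((c.2.2.2.1 * (k + 1) - (c.2.2.2.2 + 1)) *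
          ((d + 1) * (c.2.1.2 + 1) * (c.2.2.1.2 + 1))) ^ 2 := by
  obtain ⟨l, ⟨p₁, e₁⟩, ⟨p₂, e₂⟩, ⟨p₃, e₃⟩⟩ := c
  have hd : (0 : ℝ) < d + 1 := Nat.cast_add_one_pos d
  have hk : (0 : ℝ) < k + 1 := Nat.cast_add_one_pos k
  have h₁ : (0 : ℝ) < e₁ + 1 := Nat.cast_add_one_pos e₁
  have h₂ : (0 : ℝ) < e₂ + 1 := Nat.cast_add_one_pos e₂
  have h₃ : (0 : ℝ) < e₃ + 1 := Nat.cast_add_one_pos e₃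
  refine and_congr ?_ ?_
  · have h := congrArg (fun z : ℂ => ‖z‖ ^ 2) (aeval_polyOfList_mul x y d l)
    have hn : ‖(d + 1 : ℂ)‖ = d + 1 := by
      rw [← Nat.cast_succ, Complex.norm_natCast, Nat.cast_succ]
    simp only [norm_mul, norm_pow, hn, ← Complex.normSq_eq_norm_sq (_ + _)] at h
    rw [show ((horner x y d l).1 + (horner x y d l).2.1 * Complex.I : ℂ) =
      ((((horner x y d l).1 : ℝ) : ℂ) + (((horner x y d l).2.1 : ℝ) : ℂ) * Complex.I) by simp,
      Complex.normSq_add_mul_I] at h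
    dsimp only
    rw [← Int.cast_le (R := ℝ), horner_snd_snd]
    push_cast
    rw [← h, ← abs_of_nonneg (by positivity : 0 ≤ ‖_‖ * ((k : ℝ) + 1) ^ l.length),
      ← sq_le_one_iff_abs_le_one, mul_pow, mul_pow, mul_right_comm]
    exact (mul_le_iff_le_one_left (by positivity)).symm
  · have hz : ‖gaussianFrac x y d - AlgCode.center (l, (p₁, e₁), (p₂, e₂), (p₃, e₃))‖ ^ 2 =
        (x / (d + 1) - p₁ / (e₁ + 1)) ^ 2 + (y / (d + 1) - p₂ / (e₂ + 1)) ^ 2 := by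
      rw [← Complex.normSq_eq_norm_sq, Complex.normSq_apply]
      simp [AlgCode.center, RatCode.val]
      ring
    have hr : ∀ a r M : ℝ, 0 ≤ a → 0 < M → (a < r ↔ 0 < r * M ∧ a ^ 2 * M ^ 2 < (r * M) ^ 2) :=
      fun a r M ha hM =>
        ⟨fun h => ⟨mul_pos (ha.trans_lt h) hM, by rw [mul_pow]; gcongr⟩, fun h =>
          lt_of_mul_lt_mul_right (lt_of_pow_lt_pow_left₀ 2 h.1.le (by rw [mul_pow]; exact h.2))
            hM.le⟩
    set M : ℝ := (d + 1) * (e₁ + 1) * (e₂ + 1) * ((k + 1) * (e₃ + 1)) with hM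
    rw [← lt_sub_iff_add_lt, hr _ _ M (norm_nonneg _) (by positivity), hz]
    have hR : ((RatCode.val (p₃, e₃) : ℝ) - 1 / (k + 1)) * M =
        (p₃ * (k + 1) - (e₃ + 1)) * ((d + 1) * (e₁ + 1) * (e₂ + 1)) := by
      simp only [RatCode.val, hM]
      push_cast
      field_simp
    have hX : ((x / (d + 1) - p₁ / (e₁ + 1)) ^ 2 + (y / (d + 1) - p₂ / (e₂ + 1)) ^ 2 : ℝ) * M ^ 2 =
        ((x * (e₁ + 1) - p₁ * (d + 1)) * ((k + 1) * (e₂ + 1) * (e₃ + 1))) ^ 2 +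
        ((y * (e₂ + 1) - p₂ * (d + 1)) * ((k + 1) * (e₁ + 1) * (e₃ + 1))) ^ 2 := by
      rw [hM]
      field_simp
    dsimp only
    rw [hX, hR]
    norm_cast

end QuantumRandomness

namespace QuantumRandomness

/-! ### Search for projections of large mass -/

/-- The list is part of the parameter `p` because `Primrec.list_foldr` passes the whole input to the
step function. -/
theorem primrec_hornerStep :
    Primrec₂ fun (p : ((ℤ × ℤ) × ℕ) × List ℤ) (r : ℤ × ℤ × ℤ × ℤ) =>
      (r.1 * (p.1.2 + 1) * r.2.2.2 + (p.1.1.1 * r.2.1 + -(p.1.1.2 * r.2.2.1)),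
        p.1.1.1 * r.2.2.1 + p.1.1.2 * r.2.1, ((p.1.2 : ℤ) + 1) * r.2.2.2) := by
  have hadd {f g : (((ℤ × ℤ) × ℕ) × List ℤ) × ℤ × ℤ × ℤ × ℤ → ℤ} (hf : Primrec f)
    (hg : Primrec g) : Primrec fun p => f p + g p := Primrec.int_add.comp hf hg
  have hmul {f g : (((ℤ × ℤ) × ℕ) × List ℤ) × ℤ × ℤ × ℤ × ℤ → ℤ} (hf : Primrec f)
    (hg : Primrec g) : Primrec fun p => f p * g p := Primrec.int_mul.comp hf hg
  have hneg {f : (((ℤ × ℤ) × ℕ) × List ℤ) × ℤ × ℤ × ℤ × ℤ → ℤ} (hf : Primrec f) :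
    Primrec fun p => -f p := Primrec.int_neg.comp hf
  have hQ : Primrec fun p : (((ℤ × ℤ) × ℕ) × List ℤ) × ℤ × ℤ × ℤ × ℤ => p.2 := Primrec.snd
  have hX : Primrec fun p : (((ℤ × ℤ) × ℕ) × List ℤ) × ℤ × ℤ × ℤ × ℤ => p.1.1.1.1 :=
    Primrec.fst.comp (Primrec.fst.comp (Primrec.fst.comp Primrec.fst))
  have hY : Primrec fun p : (((ℤ × ℤ) × ℕ) × List ℤ) × ℤ × ℤ × ℤ × ℤ => p.1.1.1.2 :=
    Primrec.snd.comp (Primrec.fst.comp (Primrec.fst.comp Primrec.fst))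
  have hD : Primrec fun p : (((ℤ × ℤ) × ℕ) × List ℤ) × ℤ × ℤ × ℤ × ℤ => ((p.1.1.2 : ℤ) + 1) :=
    hadd (Primrec.int_natCast.comp (Primrec.snd.comp (Primrec.fst.comp Primrec.fst)))
      (Primrec.const 1)
  have hU := Primrec.fst.comp (Primrec.snd.comp hQ)
  have hV := Primrec.fst.comp (Primrec.snd.comp (Primrec.snd.comp hQ))
  have hE := Primrec.snd.comp (Primrec.snd.comp (Primrec.snd.comp hQ))
  have hA := Primrec.fst.comp hQ
  exact (hadd (hmul (hmul hA hD) hE) (hadd (hmul hX hU) (hneg (hmul hY hV)))).pair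
    ((hadd (hmul hX hV) (hmul hY hU)).pair (hmul hD hE))

theorem computable_horner {α : Type*} [Primcodable α] {x y : α → ℤ} {d : α → ℕ} {l : α → List ℤ}
    (hx : Computable x) (hy : Computable y) (hd : Computable d) (hl : Computable l) :
    Computable fun a => horner (x a) (y a) (d a) (l a) := by
  have h := Primrec.list_foldr Primrec.snd (Primrec.const ((0, 0, 1) : ℤ × ℤ × ℤ))
    primrec_hornerStep
  have h' := h.to_comp.comp (((hx.pair hy).pair hd).pair hl)
  simp only at h'
  exact h'.of_eq fun a => by rw [horner]

theorem computablePred_certifies {α : Type*} [Primcodable α] {c : α → AlgCode} {x y : α → ℤ}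
    {d k : α → ℕ} (hc : Computable c) (hx : Computable x) (hy : Computable y) (hd : Computable d)
    (hk : Computable k) :
    ComputablePred fun a => (c a).Certifies (gaussianFrac (x a) (y a) (d a)) (k a) := by
  simp only [AlgCode.certifies_iff]
  have hh := computable_horner hx hy hd (Computable.fst.comp hc)
  refine .and ?_ (.and ?_ ?_)
  · refine .int_le ?_ ?_
    all_goals
      with_reducible repeat' first
        | exact Computable.const _
        | assumption
        | apply Computable.int_add
        | apply Computable.int_sub
        | apply Computable.int_mul
        | apply Computable.int_pow
        | apply Computable.int_natCast
        | exact Computable.list_length.comp (Computable.fst.comp hc)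
        | refine Computable.fst.comp ?_
        | refine Computable.snd.comp ?_
  all_goals
    refine .int_lt ?_ ?_
    all_goals
      with_reducible repeat' first
        | exact Computable.const _
        | assumption
        | apply Computable.int_add
        | apply Computable.int_sub
        | apply Computable.int_mul
        | apply Computable.int_pow
        | apply Computable.int_natCast
        | refine Computable.fst.comp ?_
        | refine Computable.snd.comp ?_

/-- A code of a number `n` of qubits, of two `2 ^ n × 2 ^ n` matrices of Gaussian rationals with
common denominator `d + 1`, and of a precision `1 / (k + 1)`, as the tuple of `n`, `d`, `k` and the
list of the numerators. -/
abbrev MatrixPairCode : Type := ℕ × ℕ × ℕ × List (ℤ × ℤ × ℤ × ℤ)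

namespace MatrixPairCode

/-- The numerators of the entries of both matrices in a given position. -/
def entry (w : MatrixPairCode) (i j : ℕ) : ℤ × ℤ × ℤ × ℤ :=
  w.2.2.2.getD (i * 2 ^ w.1 + j) (0, 0, 0, 0)

/-- The first matrix of a code, the candidate for a projection. -/
noncomputable def proj (w : MatrixPairCode) : Matrix (Fin (2 ^ w.1)) (Fin (2 ^ w.1)) ℂ :=
  Matrix.of fun i j => gaussianFrac (w.entry i j).1 (w.entry i j).2.1 w.2.1

/-- The second matrix of a code, the candidate for an approximation of a density matrix. -/
noncomputable def approx (w : MatrixPairCode) : Matrix (Fin (2 ^ w.1)) (Fin (2 ^ w.1)) ℂ :=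
  Matrix.of fun i j => gaussianFrac (w.entry i j).2.2.1 (w.entry i j).2.2.2 w.2.1

theorem computable_entry {α : Type*} [Primcodable α] {w : α → MatrixPairCode} {i j : α → ℕ}
    (hw : Computable w) (hi : Computable i) (hj : Computable j) :
    Computable fun a => (w a).entry (i a) (j a) :=
  Computable.list_getD' (Computable.snd.comp (Computable.snd.comp (Computable.snd.comp hw)))
    ((hi.nat_mul ((Computable.const 2).nat_pow (Computable.fst.comp hw))).nat_add hj) _

theorem proj_mul_self_iff (w : MatrixPairCode) :
    w.proj * w.proj = w.proj ↔ ∀ i < 2 ^ w.1, ∀ j < 2 ^ w.1,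
      ∑ s ∈ Finset.range (2 ^ w.1), ((w.entry i s).1 * (w.entry s j).1 -
        (w.entry i s).2.1 * (w.entry s j).2.1) = (w.2.1 + 1) * (w.entry i j).1 ∧
      ∑ s ∈ Finset.range (2 ^ w.1), ((w.entry i s).1 * (w.entry s j).2.1 +
        (w.entry i s).2.1 * (w.entry s j).1) = (w.2.1 + 1) * (w.entry i j).2.1 := by
  have hd : (w.2.1 + 1 : ℝ) ≠ 0 := Nat.cast_add_one_ne_zero _
  rw [← Matrix.ext_iff, Fin.forall_iff]
  refine forall₂_congr fun i hi => ?_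
  rw [Fin.forall_iff]
  refine forall₂_congr fun j hj => ?_
  rw [Matrix.mul_apply, Complex.ext_iff, Complex.re_sum, Complex.im_sum]
  simp only [proj, Matrix.of_apply, Complex.mul_re, Complex.mul_im, gaussianFrac_re,
    gaussianFrac_im, div_mul_div_comm, ← sub_div, ← add_div, ← Finset.sum_div]
  rw [Fin.sum_univ_eq_sum_range (fun s => ((w.entry i s).1 * (w.entry s j).1 -
    (w.entry i s).2.1 * (w.entry s j).2.1 : ℝ)), Fin.sum_univ_eq_sum_range (fun s =>
      ((w.entry i s).1 * (w.entry s j).2.1 + (w.entry i s).2.1 * (w.entry s j).1 : ℝ)),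
    div_eq_div_iff (mul_ne_zero hd hd) hd, div_eq_div_iff (mul_ne_zero hd hd) hd,
    ← mul_assoc, mul_left_inj' hd, ← mul_assoc, mul_left_inj' hd, mul_comm _ (w.2.1 + 1 : ℝ),
    mul_comm _ (w.2.1 + 1 : ℝ)]
  norm_cast

theorem conjTranspose_proj_iff (w : MatrixPairCode) :
    w.proj.conjTranspose = w.proj ↔ ∀ i < 2 ^ w.1, ∀ j < 2 ^ w.1,
      (w.entry j i).1 = (w.entry i j).1 ∧ -(w.entry j i).2.1 = (w.entry i j).2.1 := by
  have hd : (w.2.1 + 1 : ℝ) ≠ 0 := Nat.cast_add_one_ne_zero _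
  rw [← Matrix.ext_iff, Fin.forall_iff]
  refine forall₂_congr fun i hi => ?_
  rw [Fin.forall_iff]
  refine forall₂_congr fun j hj => ?_
  rw [Matrix.conjTranspose_apply, Complex.ext_iff]
  simp only [proj, Matrix.of_apply, Complex.star_def, Complex.conj_re, Complex.conj_im,
    gaussianFrac_re, gaussianFrac_im, ← neg_div, div_left_inj' hd]
  norm_cast

theorem trace_proj_iff (w : MatrixPairCode) (m : ℕ) :
    2 ^ m * w.proj.trace.re = 2 ^ w.1 ↔
      2 ^ m * ∑ i ∈ Finset.range (2 ^ w.1), (w.entry i i).1 = 2 ^ w.1 * (w.2.1 + 1 : ℤ) := by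
  have hd : (w.2.1 + 1 : ℝ) ≠ 0 := Nat.cast_add_one_ne_zero _
  simp only [Matrix.trace, Matrix.diag_apply, Complex.re_sum, proj, Matrix.of_apply,
    gaussianFrac_re, ← Finset.sum_div]
  rw [Fin.sum_univ_eq_sum_range (fun s => ((w.entry s s).1 : ℝ)), mul_div_assoc', div_eq_iff hd]
  norm_cast

theorem le_trace_approx_mul_proj_iff (w : MatrixPairCode) (N : ℕ) :
    2 ≤ N * (w.approx * w.proj).trace.re ↔
      2 * (w.2.1 + 1 : ℤ) ^ 2 ≤ N * ∑ i ∈ Finset.range (2 ^ w.1), ∑ j ∈ Finset.range (2 ^ w.1),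
        ((w.entry i j).2.2.1 * (w.entry j i).1 - (w.entry i j).2.2.2 * (w.entry j i).2.1) := by
  have hd : (0 : ℝ) < w.2.1 + 1 := Nat.cast_add_one_pos _
  simp only [Matrix.trace, Matrix.diag_apply, Complex.re_sum, Matrix.mul_apply, proj, approx,
    Matrix.of_apply, Complex.mul_re, gaussianFrac_re, gaussianFrac_im, div_mul_div_comm, ← sub_div,
    ← Finset.sum_div]
  simp_rw [fun i : Fin (2 ^ w.1) => Fin.sum_univ_eq_sum_range (fun j =>
    ((w.entry i j).2.2.1 * (w.entry j i).1 - (w.entry i j).2.2.2 * (w.entry j i).2.1 : ℝ))]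
  rw [Fin.sum_univ_eq_sum_range (fun i => ∑ j ∈ Finset.range (2 ^ w.1),
    ((w.entry i j).2.2.1 * (w.entry j i).1 - (w.entry i j).2.2.2 * (w.entry j i).2.1 : ℝ)),
    mul_div_assoc', le_div_iff₀ (by positivity), ← sq]
  norm_cast

/-- `w.IsGood c N m`: the first matrix is a projection of normalized trace `2 ^ (-m)`, the
second one is a good approximation of the matrix whose entries have the codes `c`, and the trace of
their product is at least `2 / N`. -/
structure IsGood (w : MatrixPairCode) (c : ℕ × ℕ × ℕ → AlgCode) (N m : ℕ) : Prop where
  one_le : 1 ≤ w.1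
  precision : N * 4 ^ w.1 ≤ w.2.2.1
  mul_self : w.proj * w.proj = w.proj
  conjTranspose : w.proj.conjTranspose = w.proj
  trace_proj : 2 ^ m * w.proj.trace.re = 2 ^ w.1
  le_trace : 2 ≤ N * (w.approx * w.proj).trace.re
  certifies : ∀ i j : Fin (2 ^ w.1), (c (w.1, i, j)).Certifies (w.approx i j) w.2.2.1

/-- After clearing denominators, each condition is an integer equation or inequality, or a bounded
universal quantification over such. -/
theorem computablePred_isGood {c : ℕ × ℕ × ℕ → AlgCode} (hc : Computable c) (N : ℕ) :
    ComputablePred fun q : ℕ × MatrixPairCode => q.2.IsGood c N q.1 := by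
  have h1 : ComputablePred fun q : ℕ × MatrixPairCode => 1 ≤ q.2.1 := by
    refine .nat_le (Computable.const _) (Computable.fst.comp Computable.snd)
  have h2 : ComputablePred fun q : ℕ × MatrixPairCode => N * 4 ^ q.2.1 ≤ q.2.2.2.1 := by
    refine .nat_le (.nat_mul (.const _) (.nat_pow (.const _) (Computable.fst.comp Computable.snd)))
      (Computable.fst.comp (Computable.snd.comp (Computable.snd.comp Computable.snd)))
  have h3 : ComputablePred fun q : ℕ × MatrixPairCode => q.2.proj * q.2.proj = q.2.proj := by
    simp only [proj_mul_self_iff]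
    refine .forall_lt (.forall_lt (.and (.int_eq ?_ ?_) (.int_eq ?_ ?_)) ?_) ?_
    all_goals
      with_reducible repeat' first
        | exact Computable.id'
        | exact Computable.const _
        | apply Computable.int_sum_range
        | apply Computable.int_add
        | apply Computable.int_sub
        | apply Computable.int_mul
        | apply Computable.nat_pow
        | apply Computable.int_natCast
        | apply computable_entry
        | refine Computable.fst.comp ?_
        | refine Computable.snd.comp ?_
  have h4 : ComputablePred fun q : ℕ × MatrixPairCode => q.2.proj.conjTranspose = q.2.proj := by
    simp only [conjTranspose_proj_iff]
    refine .forall_lt (.forall_lt (.and (.int_eq ?_ ?_) (.int_eq ?_ ?_)) ?_) ?_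
    all_goals
      with_reducible repeat' first
        | exact Computable.id'
        | exact Computable.const _
        | apply Computable.int_neg
        | apply Computable.nat_pow
        | apply computable_entry
        | refine Computable.fst.comp ?_
        | refine Computable.snd.comp ?_
  have h5 : ComputablePred fun q : ℕ × MatrixPairCode =>
      2 ^ q.1 * q.2.proj.trace.re = 2 ^ q.2.1 := by
    simp only [trace_proj_iff]
    refine .int_eq ?_ ?_
    all_goals
      with_reducible repeat' first
        | exact Computable.id'
        | exact Computable.const _
        | apply Computable.int_sum_range
        | apply Computable.int_add
        | apply Computable.int_mul
        | apply Computable.int_pow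
        | apply Computable.nat_pow
        | apply Computable.int_natCast
        | apply computable_entry
        | refine Computable.fst.comp ?_
        | refine Computable.snd.comp ?_
  have h6 : ComputablePred fun q : ℕ × MatrixPairCode =>
      2 ≤ N * (q.2.approx * q.2.proj).trace.re := by
    simp only [le_trace_approx_mul_proj_iff]
    refine .int_le ?_ ?_
    all_goals
      with_reducible repeat' first
        | exact Computable.id'
        | exact Computable.const _
        | apply Computable.int_sum_range
        | apply Computable.int_add
        | apply Computable.int_sub
        | apply Computable.int_mul
        | apply Computable.int_pow
        | apply Computable.nat_pow
        | apply Computable.int_natCast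
        | apply computable_entry
        | refine Computable.fst.comp ?_
        | refine Computable.snd.comp ?_
  have h7 : ComputablePred fun q : ℕ × MatrixPairCode => ∀ i < 2 ^ q.2.1, ∀ j < 2 ^ q.2.1,
      (c (q.2.1, i, j)).Certifies
        (gaussianFrac (q.2.entry i j).2.2.1 (q.2.entry i j).2.2.2 q.2.2.1) q.2.2.2.1 := by
    refine .forall_lt (.forall_lt (computablePred_certifies (hc.comp
      (.pair ?_ (.pair ?_ ?_))) ?_ ?_ ?_ ?_) ?_) ?_
    all_goals
      with_reducible repeat' first
        | exact Computable.id'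
        | exact Computable.const _
        | apply Computable.nat_pow
        | apply computable_entry
        | refine Computable.fst.comp ?_
        | refine Computable.snd.comp ?_
  refine (h1.and (h2.and (h3.and (h4.and (h5.and (h6.and h7)))))).of_eq fun q => ?_
  exact ⟨fun ⟨a1, a2, a3, a4, a5, a6, a7⟩ => ⟨a1, a2, a3, a4, a5, a6, fun i j => a7 i i.2 j j.2⟩,
    fun h => ⟨h.1, h.2, h.3, h.4, h.5, h.6, fun i hi j hj => h.7 ⟨i, hi⟩ ⟨j, hj⟩⟩⟩

end MatrixPairCode

end QuantumRandomness

namespace QuantumRandomness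

open Polynomial

/-! ### Codes of Gaussian rationals -/

/-- A code of the number `(a + b i) / (d + 1)`. -/
def gaussianCode (a b : ℤ) (d : ℕ) : AlgCode :=
  ([a * a + b * b, -(2 * a * (d + 1)), (d + 1) * (d + 1)], (a, d), (b, d), (1, d))

/-- The roots of the polynomial are the number and its conjugate. They are `2 |b| / (d + 1)` apart,
so the disc of radius `1 / (d + 1)` separates them unless `b = 0`, when they coincide. -/
theorem gaussianCode_represents (a b : ℤ) (d : ℕ) :
    (gaussianCode a b d).Represents (gaussianFrac a b d) := by
  have hd : (0 : ℝ) < d + 1 := Nat.cast_add_one_pos d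
  have hd' : (d + 1 : ℂ) ≠ 0 := Nat.cast_add_one_ne_zero d
  have heval : ∀ w : ℂ, aeval w (polyOfList (gaussianCode a b d).1) =
      ((d + 1) * w - (a + b * Complex.I)) * ((d + 1) * w - (a - b * Complex.I)) := by
    intro w
    simp only [gaussianCode, polyOfList, map_add, map_mul, aeval_X, eq_intCast, map_intCast,
      map_zero]
    push_cast
    linear_combination (b * b : ℂ) * Complex.I_mul_I
  have hdisc : ∀ w : ℂ, w ∈ (gaussianCode a b d).disc ↔
      ‖w - gaussianFrac a b d‖ < 1 / (d + 1) := by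
    intro w
    have hc : (gaussianCode a b d).center = gaussianFrac a b d := by
      rw [gaussianFrac_eq_mk]
      simp [AlgCode.center, gaussianCode, RatCode.val]
    rw [AlgCode.disc, Metric.mem_ball, dist_eq_norm, hc]
    simp [gaussianCode, RatCode.val]
  refine ⟨fun h0 => ?_, fun w => ?_⟩
  -- At this point the two factors are `1 - b i` and `1 + b i`, neither of which vanishes.
  · have h := heval ((a + 1) / (d + 1))
    rw [h0, map_zero, mul_div_cancel₀ _ hd', eq_comm, mul_eq_zero] at h
    rcases h with h | h <;> simpa using congrArg Complex.re h
  rw [hdisc, heval]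
  constructor
  · rintro ⟨h1, h2⟩
    have h1' : ‖(d + 1) * w - (a + b * Complex.I)‖ < 1 := by
      have h3 : (d + 1) * w - (a + b * Complex.I) = (d + 1) * (w - gaussianFrac a b d) := by
        rw [gaussianFrac, mul_sub, mul_div_cancel₀ _ hd']
      have hn : ‖(d + 1 : ℂ)‖ = d + 1 := by
        rw [← Nat.cast_succ, Complex.norm_natCast, Nat.cast_succ]
      rwa [h3, norm_mul, hn, mul_comm, ← lt_div_iff₀ hd]
    have hw : (d + 1) * w = a + b * Complex.I := by
      rcases mul_eq_zero.1 h2 with h | h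
      · exact sub_eq_zero.1 h
      · rw [sub_eq_zero.1 h] at h1' ⊢
        rw [show (a - b * Complex.I - (a + b * Complex.I) : ℂ) = ((-(2 * b) : ℤ) : ℂ) * Complex.I by
          push_cast; ring, norm_mul, Complex.norm_I, mul_one, Complex.norm_intCast] at h1'
        have h3 : |-(2 * b)| < 1 := by exact_mod_cast h1'
        have h4 : b = 0 := by
          have := Int.abs_lt_one_iff.1 h3
          omega
        simp [h4]
    rw [gaussianFrac, eq_div_iff hd', mul_comm, hw]
  · rintro rfl
    refine ⟨by simpa using by positivity, ?_⟩
    rw [gaussianFrac, mul_div_cancel₀ _ hd', sub_self, zero_mul]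

theorem AlgCode.Represents.isAlgebraic {c : AlgCode} {z : ℂ} (h : c.Represents z) :
    IsAlgebraic ℚ z := by
  have h1 : IsAlgebraic ℤ z := ⟨polyOfList c.1, h.1, ((h.2 z).2 rfl).2⟩
  exact h1.extendScalars (algebraMap ℤ ℚ).injective_int

/-! ### Gaussian rational approximations -/

/-- Lets a fixed projection share a denominator with arbitrarily fine approximations of `ρ_n`. The
`- 1` is there because `d` stands for the denominator `d + 1`. -/
theorem gaussianFrac_mul_succ (a b : ℤ) (d t : ℕ) :
    gaussianFrac (a * (t + 1)) (b * (t + 1)) ((d + 1) * (t + 1) - 1) = gaussianFrac a b d := by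
  have hd : (d + 1 : ℂ) ≠ 0 := Nat.cast_add_one_ne_zero d
  have ht : (t + 1 : ℂ) ≠ 0 := Nat.cast_add_one_ne_zero t
  have h : (((d + 1) * (t + 1) - 1 : ℕ) : ℂ) + 1 = (d + 1) * (t + 1) := by
    rw [Nat.cast_sub (Nat.mul_pos d.succ_pos t.succ_pos)]
    push_cast
    ring
  rw [gaussianFrac, gaussianFrac, h, div_eq_div_iff (mul_ne_zero hd ht) hd]
  push_cast
  ring

theorem tendsto_gaussianFrac_floor (z : ℂ) :
    Tendsto (fun d : ℕ => gaussianFrac ⌊z.re * (d + 1)⌋ ⌊z.im * (d + 1)⌋ d) atTop (𝓝 z) := by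
  have h : ∀ x : ℝ, Tendsto (fun d : ℕ => (⌊x * (d + 1)⌋ : ℝ) / (d + 1)) atTop (𝓝 x) := by
    intro x
    have h1 : Tendsto (fun d : ℕ => x - 1 / ((d : ℝ) + 1)) atTop (𝓝 (x - 0)) :=
      tendsto_one_div_add_atTop_nhds_zero_nat.const_sub x
    rw [sub_zero] at h1
    refine tendsto_of_tendsto_of_tendsto_of_le_of_le h1 tendsto_const_nhds (fun d => ?_)
      (fun d => ?_)
    · have hd : (0 : ℝ) < d + 1 := Nat.cast_add_one_pos d
      rw [le_div_iff₀ hd, sub_mul, one_div_mul_cancel hd.ne']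
      exact (Int.sub_one_lt_floor _).le
    · have hd : (0 : ℝ) < d + 1 := Nat.cast_add_one_pos d
      exact (div_le_iff₀ hd).2 (Int.floor_le _)
  have h2 := (Complex.equivRealProdCLM.symm.continuous.tendsto (z.re, z.im)).comp
    ((h z.re).prodMk_nhds (h z.im))
  have h3 : Complex.equivRealProdCLM.symm (z.re, z.im) = z := by
    apply Complex.ext <;> simp
  rw [h3] at h2
  refine h2.congr fun d => ?_
  rw [gaussianFrac_eq_mk]
  apply Complex.ext <;> simp

/-- The entries of a finite matrix over `ℚ(i)` have a common denominator. -/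
theorem exists_common_denominator {ι : Type*} [Fintype ι] {z : ι → ℂ}
    (hz : ∀ i, z i ∈ gaussianRationals) :
    ∃ (d : ℕ) (a b : ι → ℤ), ∀ i, z i = gaussianFrac (a i) (b i) d := by
  choose a b hab using fun i => mem_gaussianRationals.1 (hz i)
  set D : ℕ := ∏ i, (a i).den * (b i).den with hD
  have hD0 : 0 < D := Finset.prod_pos fun i _ => Nat.mul_pos (a i).den_pos (b i).den_pos
  have key : ∀ q : ℚ, q.den ∣ D → ∃ n : ℤ, (n : ℚ) = q * D := by
    rintro q ⟨e, he⟩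
    refine ⟨q.num * e, ?_⟩
    rw [he]
    push_cast
    rw [← mul_assoc, Rat.mul_den_eq_num]
  have hi : ∀ i, (a i).den * (b i).den ∣ D := fun i => Finset.dvd_prod_of_mem _ (Finset.mem_univ i)
  choose x hx using fun i => key (a i) ((Dvd.intro _ rfl).trans (hi i))
  choose y hy using fun i => key (b i) ((Dvd.intro_left _ rfl).trans (hi i))
  refine ⟨D - 1, x, y, fun i => ?_⟩
  have h : ((D - 1 : ℕ) : ℂ) + 1 = D := by
    rw [Nat.cast_sub hD0]
    simp
  have hx' : (x i : ℂ) = a i * D := by exact_mod_cast congrArg (Rat.cast : ℚ → ℂ) (hx i)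
  have hy' : (y i : ℂ) = b i * D := by exact_mod_cast congrArg (Rat.cast : ℚ → ℂ) (hy i)
  have hD' : (D : ℂ) ≠ 0 := by exact_mod_cast hD0.ne'
  rw [gaussianFrac, h, eq_div_iff hD', hab, hx', hy']
  ring

theorem exists_list_getD {β : Type*} {N : ℕ} (E : Fin N → Fin N → β) (b : β) :
    ∃ l : List β, ∀ i j : Fin N, l.getD (i * N + j) b = E i j := by
  refine ⟨List.ofFn fun s : Fin (N * N) => E s.divNat s.modNat, fun i j => ?_⟩
  have h : (i : ℕ) * N + j = finProdFinEquiv (i, j) := by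
    simp [finProdFinEquiv, mul_comm, add_comm]
  have h2 := finProdFinEquiv.symm_apply_apply (i, j)
  rw [finProdFinEquiv_symm_apply, Prod.mk.injEq] at h2
  rw [h, List.getD_eq_getElem _ _ (by rw [List.length_ofFn]; exact (finProdFinEquiv (i, j)).isLt),
    List.getElem_ofFn]
  simp only [Fin.eta]
  rw [h2.1, h2.2]

/-- The entries of an orthogonal projection have modulus at most one. -/
theorem norm_entry_le_one {ι : Type*} [Fintype ι] {P : Matrix ι ι ℂ} (h1 : P * P = P)
    (h2 : P.conjTranspose = P) (i j : ι) : ‖P i j‖ ≤ 1 := by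
  have h3 : ∀ s, P i s * P s i = ((‖P i s‖ ^ 2 : ℝ) : ℂ) := by
    intro s
    have : P s i = star (P i s) := by rw [← Matrix.conjTranspose_apply, h2]
    rw [this, Complex.star_def, Complex.mul_conj, Complex.normSq_eq_norm_sq]
  -- A diagonal entry is the squared norm of its row, so it dominates its own square and is at most
  -- 1; it then bounds the whole row.
  have h4 : P i i = ((∑ s, ‖P i s‖ ^ 2 : ℝ) : ℂ) := by
    conv_lhs => rw [← h1, Matrix.mul_apply]
    rw [Complex.ofReal_sum]
    exact Finset.sum_congr rfl fun s _ => h3 s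
  have h5 : ∀ s, ‖P i s‖ ^ 2 ≤ ‖P i i‖ := by
    intro s
    rw [h4, Complex.norm_real, Real.norm_of_nonneg (by positivity)]
    exact Finset.single_le_sum (f := fun s => ‖P i s‖ ^ 2) (fun s _ => by positivity)
      (Finset.mem_univ s)
  have h6 := h5 i
  have h7 := h5 j
  have h8 : ‖P i i‖ ≤ 1 := by
    by_contra! h
    nlinarith
  exact (sq_le_one_iff₀ (norm_nonneg _)).1 (h7.trans h8)

/-! ### Good codes: soundness, existence and the resulting test -/

namespace MatrixPairCode

theorem IsGood.isStarProjection {w : MatrixPairCode} {c : ℕ × ℕ × ℕ → AlgCode} {N m : ℕ}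
    (h : w.IsGood c N m) : IsStarProjection w.proj :=
  ⟨h.mul_self, h.conjTranspose⟩

/-- Replacing `ρ_n` by its approximation changes the trace by at most `4 ^ n / (k + 1)`, as there
are `4 ^ n` products and projection entries have modulus at most 1. The precision condition makes
this at most `1 / N`, leaving `2 / N - 1 / N`. -/
theorem IsGood.inv_le_measure {ρ : QState} {w : MatrixPairCode} {c : ℕ × ℕ × ℕ → AlgCode} {N m : ℕ}
    (h : w.IsGood c N m) (hN : 0 < N)
    (hc : ∀ (n : ℕ) (i j : Fin (2 ^ n)), (c (n, i, j)).Represents (ρ.mat n i j)) :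
    (N : ℝ)⁻¹ ≤ ρ.measure w.proj := by
  have hN' : (0 : ℝ) < N := by exact_mod_cast hN
  have hk0 : 0 < w.2.2.1 :=
    (Nat.mul_pos hN (pow_pos (by norm_num) _)).trans_le h.precision
  have hk : (0 : ℝ) < w.2.2.1 + 1 := Nat.cast_add_one_pos _
  have h1 : ∀ i j, ‖ρ.mat w.1 i j - w.approx i j‖ ≤ 1 / ((w.2.2.1 : ℝ) + 1) := fun i j =>
    (hc w.1 i j).norm_sub_le (h.certifies i j) hk0
  have h2 : |((ρ.mat w.1 - w.approx) * w.proj).trace.re| ≤ (N : ℝ)⁻¹ := by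
    refine (Complex.abs_re_le_norm _).trans ?_
    have h3 : ‖((ρ.mat w.1 - w.approx) * w.proj).trace‖ ≤
        ∑ _i : Fin (2 ^ w.1), ∑ _j : Fin (2 ^ w.1), 1 / ((w.2.2.1 : ℝ) + 1) := by
      refine (norm_sum_le _ _).trans (Finset.sum_le_sum fun i _ => ?_)
      rw [Matrix.diag_apply, Matrix.mul_apply]
      refine (norm_sum_le _ _).trans (Finset.sum_le_sum fun j _ => ?_)
      rw [norm_mul, ← mul_one (1 / _)]
      exact mul_le_mul (h1 i j) (norm_entry_le_one h.mul_self h.conjTranspose j i) (norm_nonneg _)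
        (by positivity)
    refine h3.trans ?_
    have h4 : (N : ℝ) * 4 ^ w.1 ≤ w.2.2.1 := by exact_mod_cast h.precision
    simp only [Finset.sum_const, Finset.card_univ, Fintype.card_fin, nsmul_eq_mul, Nat.cast_pow,
      Nat.cast_ofNat]
    rw [← mul_assoc, ← mul_pow, mul_one_div, div_le_iff₀ hk, inv_mul_eq_div, le_div_iff₀ hN']
    norm_num
    linarith
  have h5 : ρ.measure w.proj = (w.approx * w.proj).trace.re +
      ((ρ.mat w.1 - w.approx) * w.proj).trace.re := by
    rw [QState.measure, ← Complex.add_re, ← Matrix.trace_add, ← Matrix.add_mul, add_sub_cancel]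
  have h6 : 2 * (N : ℝ)⁻¹ ≤ (w.approx * w.proj).trace.re := by
    rw [← div_eq_mul_inv, div_le_iff₀' hN']
    exact h.le_trace
  rw [h5]
  linarith [(abs_le.1 h2).1]

theorem exists_isGood {ρ : QState} {c : ℕ × ℕ × ℕ → AlgCode} {N m n : ℕ} (hn : 1 ≤ n)
    (hc : ∀ (n : ℕ) (i j : Fin (2 ^ n)), (c (n, i, j)).Represents (ρ.mat n i j))
    {P : Matrix (Fin (2 ^ n)) (Fin (2 ^ n)) ℂ} (hP : IsStarProjection P)
    (htr : 2 ^ m * P.trace = 2 ^ n) (hPρ : 2 < N * ρ.measure P)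
    (hPr : ∀ i j, P i j ∈ gaussianRationals) : ∃ w : MatrixPairCode, w.IsGood c N m := by
  obtain ⟨d, a, b, hab⟩ := exists_common_denominator (z := fun s : Fin (2 ^ n) × Fin (2 ^ n) =>
    P s.1 s.2) fun s => hPr s.1 s.2
  have hk : ∀ᶠ k : ℕ in atTop, ∀ i j : Fin (2 ^ n),
      ∀ᶠ z in 𝓝 (ρ.mat n i j), (c (n, i, j)).Certifies z k :=
    eventually_all.2 fun i => eventually_all.2 fun j => (hc n i j).eventually_certifies
  -- The precision `k` is fixed first; the denominator is then refined through multiples of `d + 1`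
  -- until the approximation is certified and the mass inequality survives.
  obtain ⟨k, hk, hkN⟩ := (hk.and (eventually_ge_atTop (N * 4 ^ n))).exists
  let D : ℕ → ℕ := fun t => (d + 1) * (t + 1) - 1
  have hD : Tendsto D atTop atTop := by
    refine tendsto_atTop_mono (fun t => ?_) tendsto_id
    have : t + 1 ≤ (d + 1) * (t + 1) := Nat.le_mul_of_pos_left _ d.succ_pos
    simp only [D, id]
    omega
  let x : ℕ → Fin (2 ^ n) → Fin (2 ^ n) → ℤ := fun t i j => ⌊(ρ.mat n i j).re * (D t + 1)⌋
  let y : ℕ → Fin (2 ^ n) → Fin (2 ^ n) → ℤ := fun t i j => ⌊(ρ.mat n i j).im * (D t + 1)⌋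
  let Z : ℕ → Matrix (Fin (2 ^ n)) (Fin (2 ^ n)) ℂ := fun t =>
    Matrix.of fun i j => gaussianFrac (x t i j) (y t i j) (D t)
  have hZ : ∀ i j, Tendsto (fun t => Z t i j) atTop (𝓝 (ρ.mat n i j)) := fun i j =>
    (tendsto_gaussianFrac_floor (ρ.mat n i j)).comp hD
  have hZ' : Tendsto Z atTop (𝓝 (ρ.mat n)) :=
    tendsto_pi_nhds.2 fun i => tendsto_pi_nhds.2 fun j => hZ i j
  have hcont : Continuous fun A : Matrix (Fin (2 ^ n)) (Fin (2 ^ n)) ℂ =>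
      (N : ℝ) * (A * P).trace.re := by fun_prop
  have ht1 : ∀ᶠ t in atTop, ∀ i j : Fin (2 ^ n), (c (n, i, j)).Certifies (Z t i j) k :=
    eventually_all.2 fun i => eventually_all.2 fun j => (hZ i j).eventually (hk i j)
  have ht2 : ∀ᶠ t in atTop, 2 < (N : ℝ) * (Z t * P).trace.re :=
    ((hcont.tendsto _).comp hZ').eventually (lt_mem_nhds hPρ)
  obtain ⟨t, ht1, ht2⟩ := (ht1.and ht2).exists
  obtain ⟨l, hl⟩ := exists_list_getD (fun i j : Fin (2 ^ n) =>
    (a (i, j) * (t + 1), b (i, j) * (t + 1), x t i j, y t i j)) (0, 0, 0, 0)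
  let w : MatrixPairCode := (n, D t, k, l)
  have hw : ∀ i j : Fin (2 ^ n), w.entry i j =
    (a (i, j) * (t + 1), b (i, j) * (t + 1), x t i j, y t i j) := hl
  have hproj : w.proj = P := by
    ext i j
    change gaussianFrac (w.entry i j).1 (w.entry i j).2.1 (D t) = P i j
    rw [hw, gaussianFrac_mul_succ]
    exact (hab (i, j)).symm
  have happrox : w.approx = Z t := by
    ext i j
    change gaussianFrac (w.entry i j).2.2.1 (w.entry i j).2.2.2 (D t) = Z t i j
    rw [hw]
    rfl
  have htr' : (2 : ℝ) ^ m * P.trace.re = 2 ^ n := by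
    have h := congrArg Complex.re htr
    have e : ∀ r : ℕ, (2 : ℂ) ^ r = ((2 ^ r : ℝ) : ℂ) := fun r => by push_cast; rfl
    rwa [e, e, Complex.re_ofReal_mul, Complex.ofReal_re] at h
  refine ⟨w, hn, hkN, ?_, ?_, ?_, ?_, ?_⟩
  · rw [hproj]; exact hP.isIdempotentElem
  · rw [hproj]; exact hP.isSelfAdjoint
  · rw [hproj]; exact htr'
  · rw [hproj, happrox]; exact ht2.le
  · rw [happrox]; exact ht1

theorem isComputableMatrixSeq {f : ℕ → MatrixPairCode} (hf : Computable f) :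
    IsComputableMatrixSeq (fun m => (f m).1) fun m => (f m).proj := by
  refine ⟨Computable.fst.comp hf, fun s => gaussianCode ((f s.1).entry s.2.1 s.2.2).1
    ((f s.1).entry s.2.1 s.2.2).2.1 (f s.1).2.1, ?_, fun m i j => gaussianCode_represents _ _ _⟩
  have hfs : Computable fun s : ℕ × ℕ × ℕ => f s.1 := hf.comp Computable.fst
  have he : Computable fun s : ℕ × ℕ × ℕ => (f s.1).entry s.2.1 s.2.2 :=
    computable_entry hfs (Computable.fst.comp Computable.snd) (Computable.snd.comp Computable.snd)
  have ha := Computable.fst.comp he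
  have hb := Computable.fst.comp (Computable.snd.comp he)
  have hd := Computable.fst.comp (Computable.snd.comp hfs)
  have hd1 := hd.int_natCast.int_add (Computable.const 1)
  have hl := Computable.list_cons.comp ((ha.int_mul ha).int_add (hb.int_mul hb))
    (Computable.list_cons.comp ((((Computable.const 2).int_mul ha).int_mul hd1).int_neg)
      (Computable.list_cons.comp (hd1.int_mul hd1) (Computable.const [])))
  exact (hl.pair ((ha.pair hd).pair ((hb.pair hd).pair ((Computable.const 1).pair hd)))).of_eq
    fun s => rfl

/-- The quantum Schnorr test given by a computable sequence of good codes. -/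
noncomputable def toTest (c : ℕ × ℕ × ℕ → AlgCode) (N : ℕ) {f : ℕ → MatrixPairCode}
    (hf : Computable f) (h : ∀ m, (f m).IsGood c N m) : QSchnorrTest :=
  -- The exact traces make the sum the geometric series with value 2, so its computability is
  -- witnessed by a constant sequence.
  have hτ : (fun m => tracialState.measure (f m).proj) = fun m => (1 / 2 : ℝ) ^ m := by
    funext m
    have h1 := (h m).trace_proj
    have e : ((2 : ℂ) ^ (f m).1)⁻¹ = (((2 ^ (f m).1)⁻¹ : ℝ) : ℂ) := by push_cast; rfl
    simp only [QState.measure, tracialState]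
    rw [Matrix.smul_mul, Matrix.one_mul, Matrix.trace_smul, smul_eq_mul, e,
      Complex.re_ofReal_mul, inv_mul_eq_div, one_div, inv_pow, div_eq_iff (by positivity), ← h1,
      inv_mul_cancel_left₀ (by positivity)]
  { qubits := fun m => (f m).1
    one_le_qubits := fun m => (h m).one_le
    proj := fun m => (f m).proj
    special := fun m => ⟨(h m).isStarProjection, fun i j =>
      (gaussianCode_represents _ _ _).isAlgebraic⟩
    computable := isComputableMatrixSeq hf
    summable := by
      rw [hτ]
      exact summable_geometric_two
    computable_sum := by
      rw [hτ, tsum_geometric_two]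
      exact ⟨fun _ => (2, 0), Computable.const _, fun n => by simp [RatCode.val]⟩ }

end MatrixPairCode

end QuantumRandomness

theorem theorem3p1 (ρ : QuantumRandomness.QState) (hcomp : ρ.IsComputable)
    (hrand : ρ.IsSchnorrRandom) :
    Tendsto (fun n : ℕ => ρ.entropy n / (n : ℝ)) atTop (𝓝 1) := by
  by_contra hlim
  obtain ⟨δ, hδ, hproj⟩ := ρ.exists_projections_of_not_tendsto hlim
  obtain ⟨-, c, hc, hcρ⟩ := hcomp
  -- With `N > 2 / δ`, a mass above `δ` exceeds `2 / N`, the strict form of the bound that the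
  -- search tests.
  obtain ⟨N, hN⟩ := exists_nat_gt (2 / δ)
  have hN0 : (0 : ℝ) < N := (by positivity : 0 < 2 / δ).trans hN
  rw [div_lt_iff₀ hδ] at hN
  obtain ⟨f, hf, hgood⟩ := (QuantumRandomness.MatrixPairCode.computablePred_isGood hc
    N).exists_computable fun m => by
      obtain ⟨n, hn, P, hP, htr, hPρ, hPr⟩ := hproj m
      exact QuantumRandomness.MatrixPairCode.exists_isGood hn hcρ hP htr
        (hN.trans (mul_lt_mul_of_pos_left hPρ hN0)) hPr
  have hNinv : (0 : ℝ) < (N : ℝ)⁻¹ := inv_pos.2 hN0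
  -- Every projection found has mass at least `1 / N`, so the test is failed at order `1 / (2N)` by
  -- all `m`.
  refine hrand (QuantumRandomness.MatrixPairCode.toTest c N hf hgood) ((N : ℝ)⁻¹ / 2)
    (half_pos hNinv) (Eventually.frequently (Eventually.of_forall fun m => ?_))
  exact (half_lt_self hNinv).trans_le ((hgood m).inv_le_measure (by exact_mod_cast hN0) hcρ)
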